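/- A relation algebra is a Boolean algebra with an associative relative multiplication ${;}$, a converse $\breve{\ }$ and an identity element $1'$ satisfying Tarski's axioms; $0'=-1'$ is the diversity element, and a diversity atom is an atom below $0'$. It is symmetric if $\breve x=x$ for all $x$, and integral if it is non-trivial and $x;y=0$ implies $x=0$ or $y=0$. It is representable if it is isomorphic to an algebra of binary relations (with union, complement relative to the largest relation, composition, converse, and identity relation) whose largest relation is an equivalence relation, and completely representable if some such isomorphism sends every existing join to the union. A completion of $\mathfrak B$ is a complete relation algebra $\mathfrak C\supseteq\mathfrak B$ in which $\mathfrak B$ is a dense subalgebra (below every non-zero element of $\mathfrak C$ there is a non-zero element of $\mathfrak B$). For $q\ge 4$, $\mathfrak E^{23}_q$ is the finite symmetric integral relation algebra with $q$ atoms such that $a;b=0'$ for distinct diversity atoms $a,b$, and $a;a=-a$ for every diversity atom $a$. An atomic symmetric integral relation algebra $\mathfrak A$ is a Monk algebra if, for some $q\geq 4$, it is obtained by splitting from a subalgebra (isomorphic to) $\mathfrak E^{23}_q$: every atom $x$ of $\mathfrak A$ lies below an atom $c(x)$ of $\mathfrak E^{23}_q$, and, for all diversity atoms $x,y$ of $\mathfrak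 A$, $x;y=c(x);c(y)$ if $x=\breve y$ and $x;y=(c(x);c(y))\cdot 0'$ if $x\neq\breve y$. The $q-1$ diversity atoms of $\mathfrak E^{23}_q$ are the colors of $\mathfrak A$. A basic $k\times k$ matrix over an atomic relation algebra is a matrix $\mu$ of atoms with $\mu_{ii}\le 1'$, $\breve\mu_{ij}=\mu_{ji}$ and $\mu_{ij}\le\mu_{il};\mu_{lj}$; it satisfies the identity condition if $\mu_{lm}=1'$ exactly when $l=m$. The algebra has the 1-point extension property if, for every $k$, every basic $k\times k$ matrix $\mu$ with the identity condition, all diversity atoms $x,y$ and all $i\neq j<k$ with $\mu_{ij}\le x;y$, there is a basic $(k+1)\times(k+1)$ matrix $\mu'$ with the identity condition that extends $\mu$ and satisfies $\mu'_{ik}=x$, $\mu'_{kj}=y$. The atom structure of a relation algebra consists of its set of atoms, the ternary relation $x;y\ge z$ on atoms, the converse operation on atoms, and the set of atoms below $1'$; the complex algebra of such a structure is the algebra of all sets of its points with the induced complex operations. Let $\mathsf K$ be the class of relation algebras that are (isomorphic to) finitely generated subalgebras of non-representable completions of atomic representable relation algebras. **Corollary.** If $\mathfrak A$ is a finite Monk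 algebra with six or more colors, then $\mathfrak A\in\mathsf K$. In fact, $\mathfrak A$ is (isomorphic to) a subalgebra of the completion of a relation algebra $\mathfrak B$ such that \begin{itemize} \item $\mathfrak B$ is a countable, atomic, symmetric, integral relation algebra that is generated by its atoms; \item every finitely generated subalgebra of $\mathfrak B$ is contained in a finite subalgebra of $\mathfrak B$ with the 1-point extension property; \item the completion of $\mathfrak B$ has the same atom structure as $\mathfrak B$, is isomorphic to the complex algebra of the atom structure of $\mathfrak B$, and is not representable; \item $\mathfrak B$ is representable but not completely representable. \end{itemize} -/

import Mathlib

universe u v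

/-- The non-Boolean operations of the similarity type of relation algebras:
relative multiplication, converse, and the identity element. -/
class RelOps (A : Type u) where
  /-- relative multiplication -/
  comp : A → A → A
  /-- converse -/
  conv : A → A
  /-- the identity element -/
  ident : A

infixl:70 " ⨾ " => RelOps.comp

/-- Relation algebras (Tarski's axioms): Boolean algebras with an associative relative
multiplication, an involutive converse and an identity element. -/
class RelationAlgebra (A : Type u) extends BooleanAlgebra A, RelOps A where
  comp_assoc : ∀ x y z : A, (x ⨾ y) ⨾ z = x ⨾ (y ⨾ z)
  sup_comp : ∀ x y z : A, (x ⊔ y) ⨾ z = x ⨾ z ⊔ y ⨾ z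
  comp_ident : ∀ x : A, x ⨾ RelOps.ident = x
  conv_conv : ∀ x : A, RelOps.conv (RelOps.conv x) = x
  conv_sup : ∀ x y : A, RelOps.conv (x ⊔ y) = RelOps.conv x ⊔ RelOps.conv y
  conv_comp : ∀ x y : A, RelOps.conv (x ⨾ y) = RelOps.conv y ⨾ RelOps.conv x
  conv_comp_compl : ∀ x y : A, RelOps.conv x ⨾ (x ⨾ y)ᶜ ≤ yᶜ

namespace RelationAlgebra

/-! ### Subalgebras -/

/-- Subalgebras of a relation algebra. -/
structure Subalgebra (A : Type u) [RelationAlgebra A] extends BooleanSubalgebra A where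
  comp_mem' : ∀ x y : A, x ∈ carrier → y ∈ carrier → x ⨾ y ∈ carrier
  conv_mem' : ∀ x : A, x ∈ carrier → RelOps.conv x ∈ carrier
  ident_mem' : (RelOps.ident : A) ∈ carrier

instance {A : Type u} [RelationAlgebra A] : SetLike (Subalgebra A) A where
  coe S := S.carrier
  coe_injective := by
    rintro ⟨S, _⟩ ⟨T, _⟩ h
    have : S = T := SetLike.coe_injective h
    subst this
    rfl

instance {A : Type u} [RelationAlgebra A] (S : Subalgebra A) : BooleanAlgebra S :=
  inferInstanceAs (BooleanAlgebra S.toBooleanSubalgebra)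

instance {A : Type u} [RelationAlgebra A] (S : Subalgebra A) : RelOps S where
  comp x y := ⟨x.1 ⨾ y.1, S.comp_mem' _ _ x.2 y.2⟩
  conv x := ⟨RelOps.conv x.1, S.conv_mem' _ x.2⟩
  ident := ⟨RelOps.ident, S.ident_mem'⟩

/-- A subalgebra is a relation algebra under the restricted operations. -/
instance {A : Type u} [RelationAlgebra A] (S : Subalgebra A) : RelationAlgebra S where
  comp_assoc x y z := Subtype.ext (comp_assoc x.1 y.1 z.1)
  sup_comp x y z := Subtype.ext (sup_comp x.1 y.1 z.1)
  comp_ident x := Subtype.ext (comp_ident x.1)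
  conv_conv x := Subtype.ext (conv_conv x.1)
  conv_sup x y := Subtype.ext (conv_sup x.1 y.1)
  conv_comp x y := Subtype.ext (conv_comp x.1 y.1)
  conv_comp_compl x y := conv_comp_compl x.1 y.1

/-- The subalgebra generated by a set of elements. -/
def closure {A : Type u} [RelationAlgebra A] (X : Set A) : Subalgebra A where
  carrier := {a | ∀ S : Subalgebra A, X ⊆ S → a ∈ S}
  supClosed' := fun _ ha _ hb S hS => S.supClosed' (ha S hS) (hb S hS)
  infClosed' := fun _ ha _ hb S hS => S.infClosed' (ha S hS) (hb S hS)
  compl_mem' := fun ha S hS => S.compl_mem' (ha S hS)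
  bot_mem' := fun S _ => S.bot_mem'
  comp_mem' := fun _ _ ha hb S hS => S.comp_mem' _ _ (ha S hS) (hb S hS)
  conv_mem' := fun _ ha S hS => S.conv_mem' _ (ha S hS)
  ident_mem' := fun S _ => S.ident_mem'

/-- A finitely generated subalgebra. -/
def Subalgebra.FG {A : Type u} [RelationAlgebra A] (F : Subalgebra A) : Prop :=
  ∃ X : Set A, X.Finite ∧ F = closure X

/-- `A` is generated by the set `X`. -/
def GeneratedBy (A : Type u) [RelationAlgebra A] (X : Set A) : Prop :=
  ∀ a : A, a ∈ closure X

/-! ### Homomorphisms -/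

/-- Homomorphisms, for arbitrary Boolean algebras with operations of the right type. -/
structure IsHom {A : Type u} {B : Type v} [BooleanAlgebra A] [RelOps A] [BooleanAlgebra B]
    [RelOps B] (f : A → B) : Prop where
  map_sup : ∀ x y, f (x ⊔ y) = f x ⊔ f y
  map_compl : ∀ x, f xᶜ = (f x)ᶜ
  map_comp : ∀ x y, f (x ⨾ y) = f x ⨾ f y
  map_conv : ∀ x, f (RelOps.conv x) = RelOps.conv (f x)
  map_ident : f RelOps.ident = RelOps.ident

/-- Embeddings, i.e. isomorphisms onto a subalgebra. -/
def IsEmbedding {A : Type u} {B : Type v} [BooleanAlgebra A] [RelOps A] [BooleanAlgebra B]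
    [RelOps B] (f : A → B) : Prop :=
  IsHom f ∧ Function.Injective f

/-- Isomorphisms. -/
def IsIso {A : Type u} {B : Type v} [BooleanAlgebra A] [RelOps A] [BooleanAlgebra B]
    [RelOps B] (f : A → B) : Prop :=
  IsHom f ∧ Function.Bijective f

/-! ### Symmetric and integral algebras, diversity atoms -/

/-- Every element is its own converse. -/
def IsSymmetric (A : Type u) [RelationAlgebra A] : Prop :=
  ∀ x : A, RelOps.conv x = x

/-- Nontrivial and without zero divisors for relative multiplication. -/
def IsIntegral (A : Type u) [RelationAlgebra A] : Prop :=
  Nontrivial A ∧ ∀ x y : A, x ⨾ y = ⊥ → x = ⊥ ∨ y = ⊥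

/-- An atom below the diversity element, the complement of the identity element. -/
def IsDiversityAtom {A : Type u} [RelationAlgebra A] (x : A) : Prop :=
  IsAtom x ∧ x ≤ (RelOps.ident : A)ᶜ

/-! ### Monk algebras -/

/-- `E` is the no 1-cycles algebra with `q` atoms (this determines `E` up to isomorphism). -/
structure IsNoOneCyclesAlgebra (q : ℕ) (E : Type u) [RelationAlgebra E] : Prop where
  finite : Finite E
  symmetric : IsSymmetric E
  integral : IsIntegral E
  card_atoms : {a : E | IsAtom a}.ncard = q
  comp_of_ne : ∀ a b : E, IsDiversityAtom a → IsDiversityAtom b → a ≠ b →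
    a ⨾ b = (RelOps.ident : E)ᶜ
  comp_self : ∀ a : E, IsDiversityAtom a → a ⨾ a = aᶜ

open scoped Classical in
/-- `A` is obtained from its subalgebra `E` by splitting; `c` and `d` are the covers of the
atoms `x` and `y`. -/
structure IsSplittingOf (A : Type u) [RelationAlgebra A] (E : Subalgebra A) : Prop where
  atomic : IsAtomic A
  atomic_sub : IsAtomic E
  exists_cover : ∀ x : A, IsAtom x → ∃ c : E, IsAtom c ∧ x ≤ c
  comp_eq : ∀ (x y : A) (c d : E), IsDiversityAtom x → IsDiversityAtom y →
    IsAtom c → IsAtom d → x ≤ c → y ≤ d →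
    x ⨾ y = if x = RelOps.conv y then (c : A) ⨾ d else ((c : A) ⨾ d) ⊓ (RelOps.ident : A)ᶜ

/-- `A` is a Monk algebra, obtained by splitting from its subalgebra `E`, which is a no 1-cycles
algebra with at least four atoms. -/
structure IsMonkAlgebra (A : Type u) [RelationAlgebra A] (E : Subalgebra A) : Prop where
  symmetric : IsSymmetric A
  integral : IsIntegral A
  noOneCycles : ∃ q : ℕ, 4 ≤ q ∧ IsNoOneCyclesAlgebra q E
  splitting : IsSplittingOf A E

/-- The colors of a Monk algebra obtained by splitting from `E`: the diversity atoms of `E`. -/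
def colors {A : Type u} [RelationAlgebra A] (E : Subalgebra A) : Set E :=
  {c | IsDiversityAtom c}

/-! ### Atom structures and complex algebras -/

/-- Relational structures of the type of atom structures. -/
structure AtomStructure (α : Type u) where
  /-- the ternary relation -/
  cycle : α → α → α → Prop
  /-- the unary operation -/
  conv : α → α
  /-- the distinguished subset -/
  ident : Set α

theorem conv_mono {A : Type u} [RelationAlgebra A] {x y : A} (h : x ≤ y) :
    RelOps.conv x ≤ RelOps.conv y := by
  have h1 := conv_sup x y
  rw [sup_eq_right.2 h] at h1
  rw [h1]
  exact le_sup_left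

theorem isAtom_conv {A : Type u} [RelationAlgebra A] {x : A} (hx : IsAtom x) :
    IsAtom (RelOps.conv x) := by
  have hbot : (RelOps.conv (⊥ : A)) = ⊥ := by
    have h := conv_mono (bot_le : (⊥ : A) ≤ RelOps.conv ⊥)
    rw [conv_conv] at h
    exact le_bot_iff.1 h
  refine ⟨fun h => hx.1 ?_, fun b hb => ?_⟩
  · rw [← conv_conv x, h, hbot]
  · have h1 : RelOps.conv b ≤ x := by
      have h := conv_mono hb.le
      rwa [conv_conv] at h
    have h2 : RelOps.conv b ≠ x := by
      intro h
      rw [← h, conv_conv] at hb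
      exact lt_irrefl _ hb
    rw [← conv_conv b, hx.2 _ (lt_of_le_of_ne h1 h2), hbot]

/-- The atom structure of a relation algebra. -/
def atomStructure (A : Type u) [RelationAlgebra A] : AtomStructure {x : A // IsAtom x} where
  cycle x y z := (z : A) ≤ (x : A) ⨾ y
  conv x := ⟨RelOps.conv (x : A), isAtom_conv x.2⟩
  ident := {x | (x : A) ≤ RelOps.ident}

/-- Isomorphisms of atom structures. -/
structure AtomStructure.IsIso {α : Type u} {β : Type v} (S : AtomStructure α)
    (T : AtomStructure β) (e : α → β) : Prop where
  bijective : Function.Bijective e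
  map_cycle : ∀ x y z, T.cycle (e x) (e y) (e z) ↔ S.cycle x y z
  map_conv : ∀ x, e (S.conv x) = T.conv (e x)
  map_ident : ∀ x, e x ∈ T.ident ↔ x ∈ S.ident

/-- The complex algebra of a structure: the Boolean algebra of all subsets, with the complex
operations. -/
def ComplexAlgebra {α : Type u} (_ : AtomStructure α) : Type u := Set α

instance {α : Type u} (S : AtomStructure α) : BooleanAlgebra (ComplexAlgebra S) :=
  inferInstanceAs (BooleanAlgebra (Set α))

instance {α : Type u} (S : AtomStructure α) : RelOps (ComplexAlgebra S) where
  comp (X Y : Set α) := {z : α | ∃ x ∈ X, ∃ y ∈ Y, S.cycle x y z}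
  conv (X : Set α) := S.conv '' X
  ident := S.ident

/-! ### Completions -/

/-- `C` is a completion of its subalgebra `B`: it is complete and `B` is dense in it. -/
structure IsCompletionOf (C : Type u) [RelationAlgebra C] (B : Subalgebra C) : Prop where
  complete : ∀ X : Set C, ∃ s : C, IsLUB X s
  dense : ∀ c : C, c ≠ ⊥ → ∃ b : C, b ∈ B ∧ b ≠ ⊥ ∧ b ≤ c

/-! ### Representations -/

/-- `ρ` is a representation of `A` on the set `U`: an embedding into the algebra of all subrelations
of an equivalence relation on `U`, namely of `ρ ⊤`. -/
structure IsRepresentation {A : Type u} [RelationAlgebra A] {U : Type v}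
    (ρ : A → Set (U × U)) : Prop where
  injective : Function.Injective ρ
  equivalence : Equivalence fun r s : U => (r, s) ∈ ρ ⊤
  map_sup : ∀ x y, ρ (x ⊔ y) = ρ x ∪ ρ y
  map_compl : ∀ x, ρ xᶜ = ρ ⊤ \ ρ x
  map_comp : ∀ x y, ρ (x ⨾ y) = {p | ∃ w, (p.1, w) ∈ ρ x ∧ (w, p.2) ∈ ρ y}
  map_conv : ∀ x, ρ (RelOps.conv x) = {p | (p.2, p.1) ∈ ρ x}
  map_ident : ρ RelOps.ident = {p | p.1 = p.2}

/-- `A` has a representation. -/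
def IsRepresentable (A : Type u) [RelationAlgebra A] : Prop :=
  ∃ (U : Type u) (ρ : A → Set (U × U)), IsRepresentation ρ

/-- `A` has a representation that sends every existing join to the union. -/
def IsCompletelyRepresentable (A : Type u) [RelationAlgebra A] : Prop :=
  ∃ (U : Type u) (ρ : A → Set (U × U)), IsRepresentation ρ ∧
    ∀ (X : Set A) (s : A), IsLUB X s → ρ s = ⋃ x ∈ X, ρ x

/-! ### The 1-point extension property -/

/-- Basic `k`-by-`k` matrices of atoms. -/
structure IsBasicMatrix {A : Type u} [RelationAlgebra A] {k : ℕ} (μ : Fin k → Fin k → A) :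
    Prop where
  atom : ∀ i j, IsAtom (μ i j)
  diag : ∀ i, μ i i ≤ RelOps.ident
  conv : ∀ i j, RelOps.conv (μ i j) = μ j i
  comp : ∀ i j l, μ i j ≤ μ i l ⨾ μ l j

/-- The identity condition for matrices. -/
def IdentityCondition {A : Type u} [RelationAlgebra A] {k : ℕ} (μ : Fin k → Fin k → A) : Prop :=
  ∀ l m, μ l m = RelOps.ident ↔ l = m

/-- The 1-point extension property. -/
def OnePointExtensionProperty (A : Type u) [RelationAlgebra A] : Prop :=
  ∀ (k : ℕ) (μ : Fin k → Fin k → A) (x y : A) (i j : Fin k),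
    IsBasicMatrix μ → IdentityCondition μ → IsDiversityAtom x → IsDiversityAtom y →
    i ≠ j → μ i j ≤ x ⨾ y →
    ∃ μ' : Fin (k + 1) → Fin (k + 1) → A, IsBasicMatrix μ' ∧ IdentityCondition μ' ∧
      (∀ l m : Fin k, μ' l.castSucc m.castSucc = μ l m) ∧
      μ' i.castSucc (Fin.last k) = x ∧ μ' (Fin.last k) j.castSucc = y

/-! ### The class of finitely generated subcompletions -/

/-- `A` is (isomorphic to) a finitely generated subalgebra of a non-representable completion of an
atomic representable relation algebra. -/
def IsFGSubcompletion (A : Type u) [RelationAlgebra A] : Prop :=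
  (∃ X : Set A, X.Finite ∧ GeneratedBy A X) ∧
  ∃ (C : Type u) (_ : RelationAlgebra C) (B : Subalgebra C),
    IsAtomic B ∧ IsRepresentable B ∧ IsCompletionOf C B ∧ ¬ IsRepresentable C ∧
    ∃ f : A → C, IsEmbedding f

end RelationAlgebra

/-!
The algebra `C` is a blow-up of the Monk algebra in which finite pieces no longer see the colors.
A blur is a set of two colors. Each diversity atom `x` of `A` is replaced by copies `(x, i, W)`, with
`i` a natural number and `W` a blur containing the color of `x`. Three copies form a cycle if their
blurs have no common color, or else if the largest of their indices occurs at least twice and their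
colors are not all equal (`splitTriples`). `C` consists of all sets of atoms, and `A` embeds in it
by sending an element to the copies of the atoms below it: copies with equal indices already realize
all cycles of `A`, and three copies of the same color never form a cycle
(`exists_embedding_of_color`).

The subalgebra `B` consists of the sets that, beyond some index, contain with one atom all atoms of
the same blur (`termAlgebra`). Such a set mixes the two colors of a blur, so `B` does not contain
the colors. The index condition makes the sets that are uniform beyond a given `M` closed under
relative multiplication (`UniformBeyond.comp`), and they form a finite subalgebra. The tails
beyond `M` are atoms of it, and any two of them form a cycle with everything, because a blur always
offers a color different from a given one.

Six colors enter through `exists_blur_noCommonColor`: a new vertex of a network with two prescribed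
edges `x`, `y` meets two constraints at each old vertex, each excluding the colors in the
intersection of two blurs, hence at most four colors together; two colors remain for the blur of
the new edge, which is labelled by a tail. This is `exists_row`. It yields the one-point extension
property of the finite subalgebras, associativity of `C` by the same count, and, applied to the atoms
together with one nonprincipal ultrafilter for each blur, a countable network that represents `B`
(`exists_network`, `isRepresentable_termAlgebra`).

A representation of `C`, or a complete one of `B`, would color the pairs of an infinite set of points
with finitely many colors and without monochromatic triangles, against Ramsey's theorem
(`finite_of_no_monochromatic`). The infinitely many points come from the disjoint atoms `(x, i, W)`,
`i = 0, 1, 2, …`.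
-/

namespace RelationAlgebra

/-! ### Blurs and triples -/

/-- A blur is a set of exactly two colors. -/
abbrev Blur (K : Type u) : Type u := {W : Finset K // W.card = 2}

/-- No color belongs to all three blurs. -/
def NoCommonColor {K : Type u} (X Y Z : Blur K) : Prop :=
  ∀ k ∈ X.1, k ∈ Y.1 → k ∉ Z.1

/-- The combinatorial content of having six colors: two intersections of blurs have at most four
elements, which leaves room for a third blur disjoint from both. -/
theorem exists_blur_noCommonColor {K : Type u} (hK : 6 ≤ Nat.card K) (X Y Z W : Blur K) :
    ∃ T : Blur K, NoCommonColor X Y T ∧ NoCommonColor Z W T := by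
  classical
  have hfin : Finite K := Nat.finite_of_card_ne_zero (by omega)
  have := Fintype.ofFinite K
  rw [Nat.card_eq_fintype_card] at hK
  have h4 : (X.1 ∪ Z.1).card ≤ 4 := by
    have h := Finset.card_union_le X.1 Z.1
    rw [X.2, Z.2] at h
    exact h
  have h2 : 2 ≤ (X.1 ∪ Z.1)ᶜ.card := by
    rw [Finset.card_compl]
    omega
  obtain ⟨T, hT, hcard⟩ := Finset.exists_subset_card_eq h2
  refine ⟨⟨T, hcard⟩, fun k hk _ hkT => ?_, fun k hk _ hkT => ?_⟩
  · have := hT hkT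
    simp [hk] at this
  · have := hT hkT
    simp [hk] at this

/-- Every color is the only common element of two blurs. -/
theorem exists_blur_pair {K : Type u} (hK : 6 ≤ Nat.card K) (a : K) :
    ∃ V W : Blur K, a ∈ V.1 ∧ a ∈ W.1 ∧ V ≠ W ∧ ∀ k ∈ V.1, k ∈ W.1 → k = a := by
  classical
  have hfin : Finite K := Nat.finite_of_card_ne_zero (by omega)
  have := Fintype.ofFinite K
  rw [Nat.card_eq_fintype_card] at hK
  have h2 : 1 < ({a} : Finset K)ᶜ.card := by
    rw [Finset.card_compl, Finset.card_singleton]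
    omega
  obtain ⟨d, hd, e, he, hde⟩ := Finset.one_lt_card.1 h2
  simp only [Finset.mem_compl, Finset.mem_singleton] at hd he
  refine ⟨⟨{a, d}, Finset.card_pair (Ne.symm hd)⟩, ⟨{a, e}, Finset.card_pair (Ne.symm he)⟩,
    by simp, by simp, fun h => ?_, fun k h₁ h₂ => ?_⟩
  · have : d ∈ ({a, e} : Finset K) := by
      have h' : ({a, d} : Finset K) = {a, e} := congrArg Subtype.val h
      rw [← h']
      simp
    simp [hd, hde] at this
  · simp only [Finset.mem_insert, Finset.mem_singleton] at h₁ h₂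
    rcases h₁ with h₁ | h₁
    · exact h₁
    · rcases h₂ with h₂ | h₂
      · exact h₂
      · exact absurd (h₁.symm.trans h₂) hde

/-- A blur contains a color other than a given one. -/
theorem Blur.exists_mem_ne {K : Type u} (W : Blur K) (k : K) : ∃ a ∈ W.1, a ≠ k :=
  Finset.exists_mem_ne (by rw [W.2]; norm_num) k

/-- The diversity cycles of a symmetric integral atom structure with diversity atoms `Δ`, each of
which carries a blur, such that three atoms whose blurs have no common color always form a
cycle. -/
structure BlurredTriples (K Δ : Type u) where
  /-- the diversity cycles -/
  tri : Δ → Δ → Δ → Prop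
  /-- the blur of a diversity atom -/
  blur : Δ → Blur K
  tri_swap : ∀ {x y z}, tri x y z → tri y x z
  tri_rot : ∀ {x y z}, tri x y z → tri y z x
  blur_surjective : Function.Surjective blur
  tri_of_noCommonColor : ∀ {x y z}, NoCommonColor (blur x) (blur y) (blur z) → tri x y z

namespace BlurredTriples

variable {K Δ : Type u} (S : BlurredTriples K Δ)

/-- A choice of one diversity atom for each blur, any two of which form a cycle with every
diversity atom. -/
structure IsBig (big : Blur K → Δ) : Prop where
  blur_big : ∀ W, S.blur (big W) = W
  tri_big : ∀ W V z, S.tri (big W) (big V) z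

/-- The one-point extension step for labelled complete graphs, on any set of vertices: the edges
from the new vertex to `i` and `j` are prescribed, and all others get big labels whose blurs avoid
the two intersections of blurs that matter. Consistency of `μ` away from `i, j` is not needed.
The case `i = j` adds a vertex with a single prescribed edge. -/
theorem exists_row (hK : 6 ≤ Nat.card K) {big : Blur K → Δ} (hbig : S.IsBig big) {P : Type v}
    (μ : P → P → Δ) (hμ : ∀ l m, μ l m = μ m l) (i j : P) (x y : Δ)
    (hij : i = j ∧ x = y ∨ i ≠ j ∧ S.tri x y (μ i j)) :
    ∃ r : P → Δ, r i = x ∧ r j = y ∧ ∀ l m, l ≠ m → S.tri (r l) (r m) (μ l m) := by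
  classical
  choose T hT₁ hT₂ using fun l : P =>
    exists_blur_noCommonColor hK (S.blur x) (S.blur (μ i l)) (S.blur y) (S.blur (μ j l))
  have h₁ : ∀ l, S.tri (big (T l)) x (μ i l) := fun l => S.tri_rot <| S.tri_rot <|
    S.tri_of_noCommonColor (by rw [hbig.blur_big]; exact hT₁ l)
  have h₂ : ∀ l, S.tri (big (T l)) y (μ j l) := fun l => S.tri_rot <| S.tri_rot <|
    S.tri_of_noCommonColor (by rw [hbig.blur_big]; exact hT₂ l)
  let r : P → Δ := fun l => if l = i then x else if l = j then y else big (T l)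
  have hri : r i = x := by simp [r]
  have hrj : r j = y := by
    rcases hij with ⟨rfl, rfl⟩ | ⟨h, -⟩
    · simp [r]
    · simp [r, Ne.symm h]
  have hr : ∀ l, l = i ∨ l = j ∨ r l = big (T l) := fun l => by
    by_cases hi : l = i
    · exact Or.inl hi
    · by_cases hj : l = j
      · exact Or.inr (Or.inl hj)
      · exact Or.inr (Or.inr (by simp [r, hi, hj]))
  have hxy : i ≠ j → S.tri x y (μ i j) := fun h => by
    rcases hij with ⟨h', -⟩ | ⟨-, h'⟩
    · exact absurd h' h
    · exact h'
  refine ⟨r, hri, hrj, fun l m hlm => ?_⟩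
  rcases hr l with rfl | rfl | hl <;> rcases hr m with rfl | rfl | hm
  · exact absurd rfl hlm
  · rw [hri, hrj]; exact hxy hlm
  · rw [hri, hm]; exact S.tri_swap (h₁ m)
  · rw [hri, hrj, hμ]; exact S.tri_swap (hxy hlm.symm)
  · exact absurd rfl hlm
  · rw [hrj, hm]; exact S.tri_swap (h₂ m)
  · rw [hri, hl, hμ]; exact h₁ l
  · rw [hrj, hl, hμ]; exact h₂ l
  · rw [hl, hm]; exact hbig.tri_big _ _ _

/-- The complete labelled graph `μ` on the natural numbers with the labels of all edges at `n`
replaced by `r`. -/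
def updateVertex (n : ℕ) (μ : ℕ → ℕ → Δ) (r : ℕ → Δ) : ℕ → ℕ → Δ :=
  fun l m => if l = n then r m else if m = n then r l else μ l m

/-- A countable network in which every cycle `x, y, N i j` is witnessed by a vertex `l`. -/
theorem exists_network [Countable Δ] (hK : 6 ≤ Nat.card K) {big : Blur K → Δ}
    (hbig : S.IsBig big) :
    ∃ N : ℕ → ℕ → Δ, (∀ i j, N i j = N j i) ∧
      (∀ i j l, i ≠ l → l ≠ j → i ≠ j → S.tri (N i l) (N l j) (N i j)) ∧
      ∀ i j x y, (i = j ∧ x = y ∨ i ≠ j ∧ S.tri x y (N i j)) →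
        ∃ l, l ≠ i ∧ l ≠ j ∧ N i l = x ∧ N l j = y := by
  classical
  obtain ⟨W⟩ : Nonempty (Blur K) := by
    have : Finite K := Nat.finite_of_card_ne_zero (by omega)
    have := Fintype.ofFinite K
    rw [Nat.card_eq_fintype_card, ← Finset.card_univ] at hK
    obtain ⟨T, -, hT⟩ := Finset.exists_subset_card_eq (show 2 ≤ Finset.univ.card by omega)
    exact ⟨⟨T, hT⟩⟩
  have : Nonempty Δ := ⟨big W⟩
  let valid : ℕ × ℕ × Δ × Δ → (ℕ → ℕ → Δ) → Prop := fun t μ =>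
    t.1 = t.2.1 ∧ t.2.2.1 = t.2.2.2 ∨ t.1 ≠ t.2.1 ∧ S.tri t.2.2.1 t.2.2.2 (μ t.1 t.2.1)
  have hrow : ∀ (t : ℕ × ℕ × Δ × Δ) (μ : ℕ → ℕ → Δ), ∃ r : ℕ → Δ, (∀ l m, μ l m = μ m l) →
      (∀ l m, l ≠ m → S.tri (r l) (r m) (μ l m)) ∧
      (valid t μ → r t.1 = t.2.2.1 ∧ r t.2.1 = t.2.2.2) := by
    intro t μ
    by_cases hv : (∀ l m, μ l m = μ m l) ∧ valid t μ
    · obtain ⟨r, h₁, h₂, h₃⟩ := S.exists_row hK hbig μ hv.1 t.1 t.2.1 t.2.2.1 t.2.2.2 hv.2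
      exact ⟨r, fun _ => ⟨h₃, fun _ => ⟨h₁, h₂⟩⟩⟩
    · exact ⟨fun _ => big W, fun h => ⟨fun _ _ _ => hbig.tri_big _ _ _,
        fun h' => absurd ⟨h, h'⟩ hv⟩⟩
  choose row hrow using hrow
  obtain ⟨e, he⟩ := exists_surjective_nat (ℕ × ℕ × Δ × Δ)
  -- The request handled at stage `n` is coded by the first component of `n`, so that every request
  -- comes up again after the vertices it mentions have been added.
  let f : ℕ → (ℕ → ℕ → Δ) → ℕ → Δ := fun n => row (e n.unpair.1)
  let M : ℕ → ℕ → ℕ → Δ := fun n =>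
    Nat.rec (fun _ _ => big W) (fun n μ => updateVertex n μ (f n μ)) n
  have hM : ∀ n, M (n + 1) = updateVertex n (M n) (f n (M n)) := fun n => rfl
  have hsymm : ∀ n l m, M n l m = M n m l := by
    intro n
    induction n with
    | zero => intro l m; rfl
    | succ n ih =>
      intro l m
      rw [hM]
      unfold updateVertex
      split_ifs with h₁ h₂ h₂
      · rw [h₁, h₂]
      · rfl
      · rfl
      · exact ih l m
  have hstep : ∀ n l m, l < n → m < n → M (n + 1) l m = M n l m := by
    intro n l m hl hm
    rw [hM]
    simp [updateVertex, hl.ne, hm.ne]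
  have hstable : ∀ n k l m, l < n → m < n → M (n + k) l m = M n l m := by
    intro n k l m hl hm
    induction k with
    | zero => rfl
    | succ k ih => rw [← add_assoc, hstep _ _ _ (by omega) (by omega), ih]
  let N : ℕ → ℕ → Δ := fun i j => M (i + j + 1) i j
  have hN : ∀ n l m, l < n → m < n → M n l m = N l m := by
    intro n l m hl hm
    have h₁ := hstable (l + m + 1) n l m (by omega) (by omega)
    have h₂ := hstable n (l + m + 1) l m hl hm
    rw [add_comm] at h₂
    rw [← h₂, h₁]
  have hNsymm : ∀ i j, N i j = N j i := fun i j => by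
    change M (i + j + 1) i j = M (j + i + 1) j i
    rw [add_comm i j]
    exact hsymm (j + i + 1) i j
  have hNrow : ∀ n l, l < n → N n l = f n (M n) l := fun n l hl => by
    rw [← hN (n + 1) n l (by omega) (by omega), hM]
    simp [updateVertex]
  have htri : ∀ n l m, l < n → m < n → l ≠ m → S.tri (N n l) (N n m) (N l m) := by
    intro n l m hl hm hlm
    rw [hNrow n l hl, hNrow n m hm, ← hN n l m hl hm]
    exact (hrow _ (M n) (hsymm n)).1 l m hlm
  refine ⟨N, hNsymm, fun i j l hil hlj hij => ?_, fun i j x y h => ?_⟩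
  · have hcases : (j < i ∧ l < i) ∨ (i < j ∧ l < j) ∨ (i < l ∧ j < l) := by omega
    rcases hcases with ⟨h₁, h₂⟩ | ⟨h₁, h₂⟩ | ⟨h₁, h₂⟩
    · exact S.tri_swap (S.tri_rot (S.tri_rot (htri i l j h₂ h₁ hlj)))
    · have := S.tri_rot (S.tri_rot (S.tri_swap (htri j i l h₁ h₂ hil)))
      rwa [hNsymm j i, hNsymm j l] at this
    · have := htri l i j h₁ h₂ hij
      rwa [hNsymm l i] at this
  · obtain ⟨a, ha⟩ := he (i, j, x, y)
    have hn : i + j + 1 ≤ Nat.pair a (i + j + 1) := Nat.right_le_pair _ _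
    set n := Nat.pair a (i + j + 1) with hn'
    have hen : e n.unpair.1 = (i, j, x, y) := by rw [hn', Nat.unpair_pair]; exact ha
    have hr := (hrow (e n.unpair.1) (M n) (hsymm n)).2
    rw [hen] at hr
    have hr' := hr (by
      change i = j ∧ x = y ∨ i ≠ j ∧ S.tri x y (M n i j)
      rwa [hN n i j (by omega) (by omega)])
    refine ⟨n, by omega, by omega, ?_, ?_⟩
    · rw [hNsymm, hNrow n i (by omega)]
      change row (e n.unpair.1) (M n) i = x
      rw [hen]
      exact hr'.1
    · rw [hNrow n j (by omega)]
      change row (e n.unpair.1) (M n) j = y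
      rw [hen]
      exact hr'.2

/-! ### The complex algebra of a system of blurred triples -/

/-- All cycles of the atom structure whose atoms are the elements of `Δ` and the identity element,
encoded as `none`. -/
def cyc : Option Δ → Option Δ → Option Δ → Prop
  | none, y, z => y = z
  | some x, none, z => some x = z
  | some x, some y, none => x = y
  | some x, some y, some z => S.tri x y z

@[simp] theorem cyc_none_left (y z : Option Δ) : S.cyc none y z ↔ y = z := Iff.rfl

@[simp] theorem cyc_none_mid (x z : Option Δ) : S.cyc x none z ↔ x = z := by
  cases x <;> rfl

@[simp] theorem cyc_none_right (x y : Option Δ) : S.cyc x y none ↔ x = y := by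
  cases x <;> cases y <;> simp [cyc, eq_comm]

@[simp] theorem cyc_some (x y z : Δ) : S.cyc (some x) (some y) (some z) ↔ S.tri x y z := Iff.rfl

theorem cyc_swap {x y z : Option Δ} (h : S.cyc x y z) : S.cyc y x z := by
  cases x <;> cases y <;> cases z <;> simp_all [S.tri_swap]

theorem cyc_rot {x y z : Option Δ} (h : S.cyc x y z) : S.cyc y z x := by
  cases x <;> cases y <;> cases z <;> simp_all [S.tri_rot]

/-- The amalgamation property behind associativity: two cycles with a common edge are completed by
a diagonal whose blur is disjoint from the two relevant intersections. -/
theorem exists_tri_tri (hK : 6 ≤ Nat.card K) (p q r t : Δ) : ∃ u, S.tri q r u ∧ S.tri p u t := by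
  obtain ⟨T, h₁, h₂⟩ :=
    exists_blur_noCommonColor hK (S.blur q) (S.blur r) (S.blur t) (S.blur p)
  obtain ⟨u, rfl⟩ := S.blur_surjective T
  exact ⟨u, S.tri_of_noCommonColor h₁, S.tri_rot (S.tri_of_noCommonColor h₂)⟩

theorem exists_cyc_cyc (hK : 6 ≤ Nat.card K) {p q r s t : Option Δ} (h₁ : S.cyc p q s)
    (h₂ : S.cyc s r t) : ∃ u, S.cyc q r u ∧ S.cyc p u t := by
  rcases p with _ | p
  · obtain rfl : q = s := h₁
    exact ⟨t, h₂, rfl⟩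
  rcases q with _ | q
  · obtain rfl : some p = s := h₁
    exact ⟨r, rfl, h₂⟩
  rcases r with _ | r
  · rw [cyc_none_mid] at h₂
    subst h₂
    exact ⟨some q, by simp, h₁⟩
  rcases t with _ | t
  · rw [cyc_none_right] at h₂
    subst h₂
    exact ⟨some p, S.cyc_rot h₁, by simp⟩
  · obtain ⟨u, h₁, h₂⟩ := S.exists_tri_tri hK p q r t
    exact ⟨some u, h₁, h₂⟩

/-- The complex algebra: all sets of diversity atoms and `none`. -/
def SetAlgebra (_ : BlurredTriples K Δ) : Type u := Set (Option Δ)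

namespace SetAlgebra

variable {S}

instance : BooleanAlgebra S.SetAlgebra := inferInstanceAs (BooleanAlgebra (Set (Option Δ)))

instance : Membership (Option Δ) S.SetAlgebra := inferInstanceAs (Membership _ (Set (Option Δ)))

instance : RelOps S.SetAlgebra where
  comp X Y := ({z | ∃ x ∈ X, ∃ y ∈ Y, S.cyc x y z} : Set (Option Δ))
  conv X := X
  ident := ({none} : Set (Option Δ))

theorem mem_comp {X Y : S.SetAlgebra} {z : Option Δ} :
    z ∈ X ⨾ Y ↔ ∃ x ∈ X, ∃ y ∈ Y, S.cyc x y z := Iff.rfl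

theorem mem_ident {z : Option Δ} : z ∈ (RelOps.ident : S.SetAlgebra) ↔ z = none := Iff.rfl

theorem mem_sup {X Y : S.SetAlgebra} {z : Option Δ} : z ∈ X ⊔ Y ↔ z ∈ X ∨ z ∈ Y := Iff.rfl

theorem mem_inf {X Y : S.SetAlgebra} {z : Option Δ} : z ∈ X ⊓ Y ↔ z ∈ X ∧ z ∈ Y := Iff.rfl

theorem mem_compl {X : S.SetAlgebra} {z : Option Δ} : z ∈ Xᶜ ↔ z ∉ X := Iff.rfl

theorem mem_top {z : Option Δ} : z ∈ (⊤ : S.SetAlgebra) := trivial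

theorem not_mem_bot {z : Option Δ} : z ∉ (⊥ : S.SetAlgebra) := id

theorem le_iff {X Y : S.SetAlgebra} : X ≤ Y ↔ ∀ z ∈ X, z ∈ Y := Iff.rfl

@[ext] theorem ext {X Y : S.SetAlgebra} (h : ∀ z, z ∈ X ↔ z ∈ Y) : X = Y := Set.ext h

theorem comp_comm (X Y : S.SetAlgebra) : X ⨾ Y = Y ⨾ X := by
  ext z
  exact ⟨fun ⟨x, hx, y, hy, h⟩ => ⟨y, hy, x, hx, S.cyc_swap h⟩,
    fun ⟨x, hx, y, hy, h⟩ => ⟨y, hy, x, hx, S.cyc_swap h⟩⟩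

/-- The singleton of an atom. -/
def single (p : Option Δ) : S.SetAlgebra := ({p} : Set (Option Δ))

theorem mem_single {p z : Option Δ} : z ∈ (single p : S.SetAlgebra) ↔ z = p := Iff.rfl

theorem single_le {p : Option Δ} {X : S.SetAlgebra} : single p ≤ X ↔ p ∈ X :=
  Set.singleton_subset_iff

theorem isAtom_single (p : Option Δ) : IsAtom (single p : S.SetAlgebra) :=
  Set.isAtom_singleton p

theorem eq_bot_or_exists_mem (X : S.SetAlgebra) : X = ⊥ ∨ ∃ p, p ∈ X :=
  Set.eq_empty_or_nonempty X

variable [hK : Fact (6 ≤ Nat.card K)]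

theorem comp_assoc_le (X Y Z : S.SetAlgebra) : (X ⨾ Y) ⨾ Z ≤ X ⨾ (Y ⨾ Z) := by
  rintro z ⟨s, ⟨x, hx, y, hy, h₁⟩, w, hw, h₂⟩
  obtain ⟨u, h₃, h₄⟩ := S.exists_cyc_cyc hK.out h₁ h₂
  exact ⟨x, hx, u, ⟨y, hy, w, hw, h₃⟩, h₄⟩

instance : RelationAlgebra S.SetAlgebra where
  comp_assoc X Y Z := by
    refine le_antisymm (comp_assoc_le X Y Z) ?_
    rw [comp_comm X, comp_comm Y, comp_comm (X ⨾ Y), comp_comm X]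
    exact comp_assoc_le Z Y X
  sup_comp X Y Z := by
    ext z
    simp only [mem_comp, mem_sup]
    grind
  comp_ident X := by
    ext z
    simp only [mem_comp, mem_ident]
    simp
  conv_conv X := rfl
  conv_sup X Y := rfl
  conv_comp X Y := comp_comm X Y
  conv_comp_compl X Y := by
    rintro z ⟨x, hx, y, hy, h⟩ hz
    exact hy ⟨x, hx, z, hz, S.cyc_swap (S.cyc_rot (S.cyc_rot h))⟩

theorem isSymmetric : IsSymmetric S.SetAlgebra := fun _ => rfl

theorem comp_eq_bot {X Y : S.SetAlgebra} (h : X ⨾ Y = ⊥) : X = ⊥ ∨ Y = ⊥ := by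
  rcases eq_bot_or_exists_mem X with hX | ⟨x, hx⟩
  · exact Or.inl hX
  rcases eq_bot_or_exists_mem Y with hY | ⟨y, hy⟩
  · exact Or.inr hY
  obtain ⟨z, hz⟩ : ∃ z, S.cyc x y z := by
    rcases x with _ | x
    · exact ⟨y, rfl⟩
    rcases y with _ | y
    · exact ⟨some x, rfl⟩
    obtain ⟨u, hu, -⟩ := S.exists_tri_tri hK.out x x y x
    exact ⟨some u, hu⟩
  have : z ∈ X ⨾ Y := ⟨x, hx, y, hy, hz⟩
  rw [h] at this
  exact absurd this not_mem_bot

end SetAlgebra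

end BlurredTriples

end RelationAlgebra

namespace RelationAlgebra

open BlurredTriples SetAlgebra

/-! ### Blowing up the diversity atoms -/

/-- The diversity atoms of the blown-up algebra: copies of the elements of `D`, indexed by a natural
number and a blur that contains the color. -/
structure SplitAtom {D K : Type u} (c : D → K) : Type u where
  /-- the element of `D` of which this is a copy -/
  base : D
  /-- the index of the copy -/
  idx : ℕ
  /-- the blur of the copy -/
  blur : Blur K
  mem : c base ∈ blur.1

/-- The diversity atoms together with one limit label for each blur. The limit labels stand for the
nonprincipal ultrafilters of the term algebra. -/
abbrev Label {D K : Type u} (c : D → K) : Type u := SplitAtom c ⊕ Blur K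

variable {D K : Type u} {c : D → K}

/-- The blur of a label. -/
def Label.blur : Label c → Blur K := Sum.elim SplitAtom.blur id

/-- The index of a label, infinite for limit labels. -/
def Label.idx : Label c → ℕ∞ := Sum.elim (fun p => (p.idx : ℕ∞)) fun _ => ⊤

/-- The color of a label; limit labels have none. -/
def Label.color : Label c → Option K := Sum.elim (fun p => some (c p.base)) fun _ => none

/-- The cycles of labels: either no color is common to the three blurs, or the largest of the three
indices occurs at least twice and the three colors are not all equal. -/
def Label.Tri (x y z : Label c) : Prop :=
  NoCommonColor (Label.blur x) (Label.blur y) (Label.blur z) ∨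
    (Label.idx x ≤ max (Label.idx y) (Label.idx z) ∧
      Label.idx y ≤ max (Label.idx x) (Label.idx z) ∧
      Label.idx z ≤ max (Label.idx x) (Label.idx y)) ∧
    ¬ ∃ a, Label.color x = some a ∧ Label.color y = some a ∧ Label.color z = some a

theorem Label.Tri.swap {x y z : Label c} (h : Label.Tri x y z) : Label.Tri y x z := by
  rcases h with h | ⟨⟨h₁, h₂, h₃⟩, h⟩
  · exact Or.inl fun k hy hx => h k hx hy
  · exact Or.inr ⟨⟨h₂, h₁, max_comm (Label.idx x) _ ▸ h₃⟩,
      fun ⟨a, hy, hx, hz⟩ => h ⟨a, hx, hy, hz⟩⟩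

theorem Label.Tri.rot {x y z : Label c} (h : Label.Tri x y z) : Label.Tri y z x := by
  rcases h with h | ⟨⟨h₁, h₂, h₃⟩, h⟩
  · exact Or.inl fun k hy hz hx => h k hx hy hz
  · exact Or.inr ⟨⟨max_comm (Label.idx x) _ ▸ h₂, max_comm (Label.idx x) _ ▸ h₃, h₁⟩,
      fun ⟨a, hy, hz, hx⟩ => h ⟨a, hx, hy, hz⟩⟩

theorem Label.tri_inl {p q r : SplitAtom c} :
    Label.Tri (.inl p) (.inl q) (.inl r) ↔ NoCommonColor p.blur q.blur r.blur ∨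
      (p.idx ≤ max q.idx r.idx ∧ q.idx ≤ max p.idx r.idx ∧ r.idx ≤ max p.idx q.idx) ∧
        ¬ (c p.base = c r.base ∧ c q.base = c r.base) := by
  have hm : ∀ m n : ℕ, max (m : ℕ∞) n = ((max m n : ℕ) : ℕ∞) := fun m n => by norm_cast
  simp only [Label.Tri, Label.blur, Label.idx, Label.color, Sum.elim_inl, hm, Nat.cast_le,
    Option.some.injEq]
  refine or_congr Iff.rfl (and_congr Iff.rfl (not_congr ⟨?_, ?_⟩))
  · rintro ⟨a, h₁, h₂, h₃⟩
    exact ⟨h₁.trans h₃.symm, h₂.trans h₃.symm⟩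
  · rintro ⟨h₁, h₂⟩
    exact ⟨_, h₁, h₂, rfl⟩

/-- With exactly one limit label, the indices contribute no cycles. -/
theorem Label.tri_inr {p q : SplitAtom c} {W : Blur K} :
    Label.Tri (.inl p) (.inl q) (.inr W) ↔ NoCommonColor p.blur q.blur W := by
  have hm : ∀ m n : ℕ, max (m : ℕ∞) n = ((max m n : ℕ) : ℕ∞) := fun m n => by norm_cast
  simp only [Label.Tri, Label.blur, Label.idx, Label.color, Sum.elim_inl, Sum.elim_inr, hm]
  simp

theorem Label.tri_inr_inr (x : Label c) (V W : Blur K) : Label.Tri x (.inr V) (.inr W) :=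
  Or.inr ⟨by simp [Label.idx], fun ⟨a, _, h, _⟩ => by simp [Label.color] at h⟩

/-- Atoms with a prescribed blur and index, avoiding a color. -/
theorem SplitAtom.exists_color_ne (hc : Function.Surjective c) (n : ℕ) (W : Blur K) (k : K) :
    ∃ p : SplitAtom c, p.idx = n ∧ p.blur = W ∧ c p.base ≠ k := by
  obtain ⟨a, ha, hak⟩ := W.exists_mem_ne k
  obtain ⟨x, rfl⟩ := hc a
  exact ⟨⟨x, n, W, ha⟩, rfl, rfl, hak⟩

theorem SplitAtom.exists_blur_eq (hc : Function.Surjective c) (n : ℕ) (W : Blur K) :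
    ∃ p : SplitAtom c, p.idx = n ∧ p.blur = W := by
  obtain ⟨a, ha⟩ := Finset.card_pos.1 (show 0 < W.1.card by rw [W.2]; norm_num)
  obtain ⟨p, h₁, h₂, -⟩ := SplitAtom.exists_color_ne hc n W a
  exact ⟨p, h₁, h₂⟩

/-- The cycles of the labels. -/
def labelTriples (c : D → K) : BlurredTriples K (Label c) where
  tri := Label.Tri
  blur := Label.blur
  tri_swap := Label.Tri.swap
  tri_rot := Label.Tri.rot
  blur_surjective W := ⟨.inr W, rfl⟩
  tri_of_noCommonColor := Or.inl

theorem labelTriples_isBig : (labelTriples c).IsBig Sum.inr where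
  blur_big _ := rfl
  tri_big W V z := Label.Tri.rot (Label.tri_inr_inr z W V)

/-- The diversity cycles of the blown-up algebra. -/
def splitTriples (hc : Function.Surjective c) : BlurredTriples K (SplitAtom c) where
  tri p q r := Label.Tri (.inl p) (.inl q) (.inl r)
  blur := SplitAtom.blur
  tri_swap := Label.Tri.swap
  tri_rot := Label.Tri.rot
  blur_surjective W := by
    obtain ⟨p, -, h⟩ := SplitAtom.exists_blur_eq hc 0 W
    exact ⟨p, h⟩
  tri_of_noCommonColor := Or.inl

variable (hc : Function.Surjective c)

theorem splitTriples_tri {p q r : SplitAtom c} :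
    (splitTriples hc).tri p q r ↔ NoCommonColor p.blur q.blur r.blur ∨
      (p.idx ≤ max q.idx r.idx ∧ q.idx ≤ max p.idx r.idx ∧ r.idx ≤ max p.idx q.idx) ∧
        ¬ (c p.base = c r.base ∧ c q.base = c r.base) := Label.tri_inl

/-- There are no cycles of three atoms of the same color. -/
theorem not_tri_of_color_eq {p q r : SplitAtom c} (h₁ : c p.base = c r.base)
    (h₂ : c q.base = c r.base) : ¬ (splitTriples hc).tri p q r := by
  rw [splitTriples_tri]
  rintro (h | ⟨-, h⟩)
  · exact h (c r.base) (h₁ ▸ p.mem) (h₂ ▸ q.mem) r.mem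
  · exact h ⟨h₁, h₂⟩

/-- The blown-up algebra, of all sets of atoms. -/
abbrev SplitAlgebra (hc : Function.Surjective c) : Type u := (splitTriples hc).SetAlgebra

/-! ### The term algebra -/

/-- The set `X` does not split, beyond the index `M`, the atoms with the same blur. -/
def UniformBeyond {hc : Function.Surjective c} (M : ℕ) (X : SplitAlgebra hc) : Prop :=
  ∀ p q : SplitAtom c, p.blur = q.blur → M ≤ p.idx → M ≤ q.idx → some p ∈ X → some q ∈ X

theorem UniformBeyond.mono {M N : ℕ} (h : M ≤ N) {X : SplitAlgebra hc} (hX : UniformBeyond M X) :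
    UniformBeyond N X :=
  fun p q hpq hp hq => hX p q hpq (h.trans hp) (h.trans hq)

/-- Sets that do not split tails are closed under relative multiplication: an index `≥ M` of a
factor can be changed to that of the product, at the price of changing the color. -/
theorem UniformBeyond.comp {M : ℕ} {X Y : SplitAlgebra hc} (hX : UniformBeyond M X)
    (hY : UniformBeyond M Y) : UniformBeyond M (X ⨾ Y) := by
  rintro r r' hr hrM hrM' ⟨x, hx, y, hy, h⟩
  rcases x with _ | p
  · rw [cyc_none_left] at h
    subst h
    exact ⟨none, hx, some r', hY r r' hr hrM hrM' hy, rfl⟩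
  rcases y with _ | q
  · rw [cyc_none_mid] at h
    rw [h] at hx
    exact ⟨some r', hX r r' hr hrM hrM' hx, none, hy, by simp⟩
  rw [cyc_some] at h
  obtain ⟨p', hpi, hpb, hpc⟩ := SplitAtom.exists_color_ne hc r'.idx p.blur (c r'.base)
  obtain ⟨q', hqi, hqb, hqc⟩ := SplitAtom.exists_color_ne hc r'.idx q.blur (c r'.base)
  by_cases hpM : p.idx < M <;> by_cases hqM : q.idx < M
  · refine ⟨some p, hx, some q, hy, ?_⟩
    rw [splitTriples_tri] at h
    rw [cyc_some, splitTriples_tri]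
    rcases h with h | ⟨⟨-, -, h⟩, -⟩
    · exact Or.inl (hr ▸ h)
    · exact absurd (hrM.trans h) (by simp [hpM, hqM])
  · refine ⟨some p, hx, some q', hY q q' hqb.symm (by omega) (by omega) hy, ?_⟩
    rw [cyc_some, splitTriples_tri]
    exact Or.inr ⟨⟨by omega, by omega, by omega⟩, fun h => hqc h.2⟩
  · refine ⟨some p', hX p p' hpb.symm (by omega) (by omega) hx, some q, hy, ?_⟩
    rw [cyc_some, splitTriples_tri]
    exact Or.inr ⟨⟨by omega, by omega, by omega⟩, fun h => hpc h.1⟩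
  · refine ⟨some p', hX p p' hpb.symm (by omega) (by omega) hx,
      some q', hY q q' hqb.symm (by omega) (by omega) hy, ?_⟩
    rw [cyc_some, splitTriples_tri]
    exact Or.inr ⟨⟨by omega, by omega, by omega⟩, fun h => hqc h.2⟩

variable [hK : Fact (6 ≤ Nat.card K)]

/-- The subalgebra of the sets that, beyond the index `M`, do not split the atoms with the same
blur. -/
def uniformSubalgebra (M : ℕ) : Subalgebra (SplitAlgebra hc) where
  carrier := {X | UniformBeyond M X}
  supClosed' _ hX _ hY := fun p q h hp hq hpX =>
    hpX.imp (hX p q h hp hq) (hY p q h hp hq)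
  infClosed' _ hX _ hY := fun p q h hp hq hpX =>
    ⟨hX p q h hp hq hpX.1, hY p q h hp hq hpX.2⟩
  compl_mem' hX := fun p q h hp hq hpX hqX => hpX (hX q p h.symm hq hp hqX)
  bot_mem' := fun _ _ _ _ _ h => h
  comp_mem' _ _ hX hY := hX.comp hc hY
  conv_mem' _ hX := hX
  ident_mem' := fun _ _ _ _ _ h => absurd h (by simp [mem_ident])

/-- The term algebra: the sets that, for each blur, contain all or none of the atoms with that blur
beyond some index. -/
def termAlgebra : Subalgebra (SplitAlgebra hc) where
  carrier := {X | ∃ M, UniformBeyond M X}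
  supClosed' := by
    rintro X ⟨M, hX⟩ Y ⟨N, hY⟩
    exact ⟨max M N, (uniformSubalgebra hc _).supClosed'
      (hX.mono hc (le_max_left _ _)) (hY.mono hc (le_max_right _ _))⟩
  infClosed' := by
    rintro X ⟨M, hX⟩ Y ⟨N, hY⟩
    exact ⟨max M N, (uniformSubalgebra hc _).infClosed'
      (hX.mono hc (le_max_left _ _)) (hY.mono hc (le_max_right _ _))⟩
  compl_mem' := by
    rintro X ⟨M, hX⟩
    exact ⟨M, (uniformSubalgebra hc M).compl_mem' hX⟩
  bot_mem' := ⟨0, (uniformSubalgebra hc 0).bot_mem'⟩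
  comp_mem' := by
    rintro X Y ⟨M, hX⟩ ⟨N, hY⟩
    exact ⟨max M N, (hX.mono hc (le_max_left _ _)).comp hc (hY.mono hc (le_max_right _ _))⟩
  conv_mem' _ hX := hX
  ident_mem' := ⟨0, (uniformSubalgebra hc 0).ident_mem'⟩

theorem mem_termAlgebra {X : SplitAlgebra hc} :
    X ∈ termAlgebra hc ↔ ∃ M, UniformBeyond M X := Iff.rfl

theorem single_mem_termAlgebra (p : Option (SplitAtom c)) :
    (single p : SplitAlgebra hc) ∈ termAlgebra hc := by
  refine ⟨(p.elim 0 SplitAtom.idx) + 1, fun q r _ hq _ h => ?_⟩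
  rw [mem_single] at h
  subst h
  exact absurd hq (by simp)

end RelationAlgebra

namespace RelationAlgebra

open BlurredTriples SetAlgebra

variable {D K : Type u} {c : D → K} (hc : Function.Surjective c)

theorem isAtom_split_iff {X : SplitAlgebra hc} : IsAtom X ↔ ∃ p, X = single p := by
  constructor
  · intro h
    rcases eq_bot_or_exists_mem X with h' | ⟨p, hp⟩
    · exact absurd h' h.1
    · rcases h.le_iff.1 (single_le.2 hp) with h' | h'
      · exact absurd h' (isAtom_single p).1
      · exact ⟨p, h'.symm⟩
  · rintro ⟨p, rfl⟩
    exact isAtom_single p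

/-- The atoms with blur `W` and index at least `M`. -/
def tail (W : Blur K) (M : ℕ) : SplitAlgebra hc :=
  ({z | ∃ p, z = some p ∧ p.blur = W ∧ M ≤ p.idx} : Set (Option (SplitAtom c)))

theorem some_mem_tail {W : Blur K} {M : ℕ} {p : SplitAtom c} :
    some p ∈ tail hc W M ↔ p.blur = W ∧ M ≤ p.idx :=
  ⟨fun ⟨_, hq, h⟩ => by rw [Option.some.inj hq]; exact h, fun h => ⟨p, rfl, h⟩⟩

theorem uniformBeyond_tail (W : Blur K) {M N : ℕ} (h : M ≤ N) :
    UniformBeyond N (tail hc W M) := fun p q hpq _ hq hp => by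
  rw [some_mem_tail] at hp ⊢
  exact ⟨hpq ▸ hp.1, h.trans hq⟩

theorem exists_mem_tail (W : Blur K) (M : ℕ) : ∃ p : SplitAtom c, some p ∈ tail hc W M := by
  obtain ⟨p, h₁, h₂⟩ := SplitAtom.exists_blur_eq hc M W
  exact ⟨p, (some_mem_tail hc).2 ⟨h₂, h₁.ge⟩⟩

variable [hK : Fact (6 ≤ Nat.card K)]

theorem Subalgebra.isSymmetric {A : Type u} [RelationAlgebra A] (h : IsSymmetric A)
    (B : Subalgebra A) : IsSymmetric B := fun x => Subtype.ext (h x.1)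

theorem Subalgebra.isIntegral {A : Type u} [RelationAlgebra A] (h : IsIntegral A)
    (B : Subalgebra A) : IsIntegral B := by
  obtain ⟨hne, h⟩ := h
  refine ⟨⟨⊥, ⊤, fun h' => bot_ne_top (α := A) (congrArg Subtype.val h')⟩, fun x y hxy => ?_⟩
  rcases h x.1 y.1 (congrArg Subtype.val hxy) with h' | h'
  · exact Or.inl (Subtype.ext h')
  · exact Or.inr (Subtype.ext h')

theorem splitAlgebra_isIntegral : IsIntegral (SplitAlgebra hc) := by
  refine ⟨⟨⊥, single none, fun h => ?_⟩, fun X Y => comp_eq_bot⟩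
  exact (isAtom_single (S := splitTriples hc) none).1 h.symm

/-! ### Atoms, completion and atom structure of the term algebra -/

/-- The singleton of an atom as an element of the term algebra. -/
def termSingle (p : Option (SplitAtom c)) : termAlgebra hc :=
  ⟨single p, single_mem_termAlgebra hc p⟩

theorem termSingle_le {p : Option (SplitAtom c)} {X : termAlgebra hc} :
    termSingle hc p ≤ X ↔ p ∈ X.1 := single_le (X := X.1)

theorem isAtom_termSingle (p : Option (SplitAtom c)) : IsAtom (termSingle hc p) := by
  have h := isAtom_single (S := splitTriples hc) p
  refine ⟨fun h' => h.1 (congrArg Subtype.val h'), fun b hb => Subtype.ext (h.2 b.1 ?_)⟩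
  exact hb

theorem exists_termSingle_le {X : termAlgebra hc} (hX : X ≠ ⊥) : ∃ p, termSingle hc p ≤ X := by
  rcases eq_bot_or_exists_mem X.1 with h | ⟨p, hp⟩
  · exact absurd (Subtype.ext h) hX
  · exact ⟨p, (termSingle_le hc).2 hp⟩

theorem isAtom_term_iff {X : termAlgebra hc} : IsAtom X ↔ ∃ p, X = termSingle hc p := by
  constructor
  · intro h
    obtain ⟨p, hp⟩ := exists_termSingle_le hc h.1
    rcases h.le_iff.1 hp with h' | h'
    · exact absurd h' (isAtom_termSingle hc p).1
    · exact ⟨p, h'.symm⟩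
  · rintro ⟨p, rfl⟩
    exact isAtom_termSingle hc p

theorem termAlgebra_isAtomic : IsAtomic (termAlgebra hc) := ⟨fun X => by
  by_cases h : X = ⊥
  · exact Or.inl h
  · obtain ⟨p, hp⟩ := exists_termSingle_le hc h
    exact Or.inr ⟨_, isAtom_termSingle hc p, hp⟩⟩

theorem isCompletionOf_termAlgebra : IsCompletionOf (SplitAlgebra hc) (termAlgebra hc) where
  complete X := ⟨(⋃₀ X : Set (Option (SplitAtom c))),
    fun _ hY _ hz => ⟨_, hY, hz⟩, fun _ hZ _ ⟨Y, hY, hz⟩ => hZ hY hz⟩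
  dense X hX := by
    rcases eq_bot_or_exists_mem X with h | ⟨p, hp⟩
    · exact absurd h hX
    · exact ⟨single p, single_mem_termAlgebra hc p, (isAtom_single p).1, single_le.2 hp⟩

theorem exists_atomStructure_isIso :
    ∃ e : {b : termAlgebra hc // IsAtom b} → {x : SplitAlgebra hc // IsAtom x},
      (∀ b, (e b : SplitAlgebra hc) = ((b : termAlgebra hc) : SplitAlgebra hc)) ∧
      (atomStructure (termAlgebra hc)).IsIso (atomStructure (SplitAlgebra hc)) e := by
  have h : ∀ b : termAlgebra hc, IsAtom b → IsAtom b.1 := fun b hb => by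
    obtain ⟨p, rfl⟩ := (isAtom_term_iff hc).1 hb
    exact isAtom_single p
  refine ⟨fun b => ⟨b.1.1, h b.1 b.2⟩, fun b => rfl, ⟨fun a b hab => ?_, fun x => ?_⟩,
    fun x y z => Iff.rfl, fun x => rfl, fun x => Iff.rfl⟩
  · have h' := Subtype.ext_iff.1 hab
    exact Subtype.ext (Subtype.ext h')
  · obtain ⟨x, hx⟩ := x
    obtain ⟨p, rfl⟩ := (isAtom_split_iff hc).1 hx
    exact ⟨⟨termSingle hc p, isAtom_termSingle hc p⟩, rfl⟩

theorem exists_complexAlgebra_isIso :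
    ∃ g : SplitAlgebra hc → ComplexAlgebra (atomStructure (termAlgebra hc)), IsIso g := by
  let g : SplitAlgebra hc → Set {b : termAlgebra hc // IsAtom b} := fun X => {b | b.1.1 ≤ X}
  have hg : ∀ (X : SplitAlgebra hc) p h, (⟨termSingle hc p, h⟩ : {b : termAlgebra hc // IsAtom b}) ∈
      g X ↔ p ∈ X := fun X p h => single_le
  have hat : ∀ b : {b : termAlgebra hc // IsAtom b},
      ∃ p, b = ⟨termSingle hc p, isAtom_termSingle hc p⟩ := fun b => by
    obtain ⟨p, hp⟩ := (isAtom_term_iff hc).1 b.2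
    exact ⟨p, Subtype.ext hp⟩
  have hext : ∀ Y Z : Set {b : termAlgebra hc // IsAtom b},
      (∀ p, (⟨termSingle hc p, isAtom_termSingle hc p⟩ : {b : termAlgebra hc // IsAtom b}) ∈ Y ↔
        (⟨termSingle hc p, isAtom_termSingle hc p⟩ : {b : termAlgebra hc // IsAtom b}) ∈ Z) →
      Y = Z := fun Y Z h => Set.ext fun b => by
    obtain ⟨p, rfl⟩ := hat b
    exact h p
  refine ⟨g, ⟨fun X Y => hext _ _ fun p => ?_, fun X => hext _ _ fun p => ?_,
    fun X Y => hext _ _ fun p => ?_, fun X => hext _ _ fun p => ?_, rfl⟩, fun X Y h => ?_,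
    fun Y => ?_⟩
  · rw [hg]
    exact or_congr (hg X p _).symm (hg Y p _).symm
  · rw [hg]
    exact not_congr (hg X p _).symm
  · rw [hg, mem_comp]
    constructor
    · rintro ⟨x, hx, y, hy, h⟩
      refine ⟨⟨termSingle hc x, isAtom_termSingle hc x⟩, (hg X x _).2 hx,
        ⟨termSingle hc y, isAtom_termSingle hc y⟩, (hg Y y _).2 hy, ?_⟩
      exact (termSingle_le hc).2 ⟨x, rfl, y, rfl, h⟩
    · rintro ⟨x, hx, y, hy, h⟩
      obtain ⟨x, rfl⟩ := hat x
      obtain ⟨y, rfl⟩ := hat y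
      obtain ⟨x', hx', y', hy', h'⟩ := (termSingle_le hc).1 h
      rw [mem_single.1 hx', mem_single.1 hy'] at h'
      exact ⟨x, (hg X x _).1 hx, y, (hg Y y _).1 hy, h'⟩
  · change _ ↔ ∃ a ∈ g X, (atomStructure (termAlgebra hc)).conv a = _
    refine ⟨fun h => ⟨_, h, rfl⟩, ?_⟩
    rintro ⟨b, hb, h⟩
    have h' : b = ⟨termSingle hc p, isAtom_termSingle hc p⟩ := h
    rw [h'] at hb
    exact hb
  · ext p
    rw [← hg X p (isAtom_termSingle hc p), h, hg]
  · let Y' : Set {b : termAlgebra hc // IsAtom b} := Y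
    refine ⟨({p | ⟨termSingle hc p, isAtom_termSingle hc p⟩ ∈ Y'} : Set _),
      hext _ Y' fun p => ?_⟩
    exact hg _ p _

/-! ### Finite subalgebras of the term algebra -/

/-- The identity element and the atoms of index less than `M`. -/
def lowAtoms (c : D → K) (M : ℕ) : Set (Option (SplitAtom c)) :=
  {z | ∀ p, z = some p → p.idx < M}

theorem finite_lowAtoms [Finite D] (c : D → K) (M : ℕ) : (lowAtoms c M).Finite := by
  have : Finite K := Nat.finite_of_card_ne_zero (by have := hK.out; omega)
  have hf : Finite (Option (D × Fin M × Blur K)) := inferInstance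
  let f : lowAtoms c M → Option (D × Fin M × Blur K) := fun z =>
    match z with
    | ⟨none, _⟩ => none
    | ⟨some p, h⟩ => some (p.base, ⟨p.idx, h p rfl⟩, p.blur)
  have hfi : Function.Injective f := by
    rintro ⟨_ | ⟨x, i, W, hW⟩, hp⟩ ⟨_ | ⟨y, j, V, hV⟩, hq⟩ h
    · rfl
    · simp [f] at h
    · simp [f] at h
    · simp only [f, Option.some.injEq, Prod.mk.injEq, Fin.mk.injEq] at h
      obtain ⟨rfl, rfl, rfl⟩ := h
      rfl
  have := Finite.of_injective f hfi
  exact Set.toFinite _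

theorem finite_uniformSubalgebra [Finite D] (M : ℕ) :
    {X : SplitAlgebra hc | UniformBeyond M X}.Finite := by
  have : Finite K := Nat.finite_of_card_ne_zero (by have := hK.out; omega)
  have : Finite (lowAtoms c M) := finite_lowAtoms c M
  let f : SplitAlgebra hc → Set (lowAtoms c M) × Set (Blur K) := fun X =>
    ({z | z.1 ∈ X}, {W | ∃ p, some p ∈ tail hc W M ∧ some p ∈ X})
  refine Set.Finite.of_finite_image (f := f) (Set.toFinite _) fun X hX Y hY h => ?_
  have h₁ : ∀ z : lowAtoms c M, z.1 ∈ X ↔ z.1 ∈ Y := fun z => by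
    have := congrArg (fun s => z ∈ s) (congrArg Prod.fst h)
    exact iff_of_eq this
  have h₂ : ∀ W, (∃ p, some p ∈ tail hc W M ∧ some p ∈ X) ↔
      ∃ p, some p ∈ tail hc W M ∧ some p ∈ Y := fun W => by
    have := congrArg (fun s => W ∈ s) (congrArg Prod.snd h)
    exact iff_of_eq this
  have hmem : ∀ Z : SplitAlgebra hc, UniformBeyond M Z → ∀ p : SplitAtom c, M ≤ p.idx →
      (some p ∈ Z ↔ ∃ q, some q ∈ tail hc p.blur M ∧ some q ∈ Z) := fun Z hZ p hp =>
    ⟨fun h => ⟨p, (some_mem_tail hc).2 ⟨rfl, hp⟩, h⟩, fun ⟨q, hq, h⟩ => by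
      rw [some_mem_tail] at hq
      exact hZ q p hq.1 hq.2 hp h⟩
  ext z
  by_cases hz : z ∈ lowAtoms c M
  · exact h₁ ⟨z, hz⟩
  · obtain ⟨p, rfl, hp⟩ : ∃ p, z = some p ∧ M ≤ p.idx := by
      simpa [lowAtoms] using hz
    rw [hmem X hX p hp, hmem Y hY p hp, h₂]

theorem countable_termAlgebra [Finite D] : Countable (termAlgebra hc) := by
  have h : {X : SplitAlgebra hc | X ∈ termAlgebra hc} =
      ⋃ M, {X : SplitAlgebra hc | UniformBeyond M X} := by
    ext X
    simp [mem_termAlgebra]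
  have h' : {X : SplitAlgebra hc | X ∈ termAlgebra hc}.Countable := by
    rw [h]
    exact Set.countable_iUnion fun M => (finite_uniformSubalgebra hc M).countable
  exact h'.to_subtype

/-- `uniformSubalgebra` as a subalgebra of the term algebra. -/
def termUniform (M : ℕ) : Subalgebra (termAlgebra hc) where
  carrier := {X | UniformBeyond M X.1}
  supClosed' _ hX _ hY := (uniformSubalgebra hc M).supClosed' hX hY
  infClosed' _ hX _ hY := (uniformSubalgebra hc M).infClosed' hX hY
  compl_mem' hX := (uniformSubalgebra hc M).compl_mem' hX
  bot_mem' := (uniformSubalgebra hc M).bot_mem'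
  comp_mem' _ _ hX hY := (uniformSubalgebra hc M).comp_mem' _ _ hX hY
  conv_mem' _ hX := hX
  ident_mem' := (uniformSubalgebra hc M).ident_mem'

theorem finite_termUniform [Finite D] (M : ℕ) : Finite (termUniform hc M) := by
  have : Finite {X : SplitAlgebra hc // UniformBeyond M X} := finite_uniformSubalgebra hc M
  exact Finite.of_injective
    (fun X : termUniform hc M => (⟨X.1.1, X.2⟩ : {X : SplitAlgebra hc // UniformBeyond M X}))
    fun X Y h => by
      have h' := Subtype.ext_iff.1 h
      exact Subtype.ext (Subtype.ext h')

theorem exists_subset_termUniform (F : Subalgebra (termAlgebra hc)) (hF : F.FG) :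
    ∃ M, (F : Set (termAlgebra hc)) ⊆ termUniform hc M := by
  obtain ⟨s, hs, rfl⟩ := hF
  have h : ∃ M, ∀ X ∈ s, UniformBeyond M X.1 := by
    induction s, hs using Set.Finite.induction_on with
    | empty => exact ⟨0, by simp⟩
    | @insert Y s _ _ ih =>
      obtain ⟨M, hM⟩ := ih
      obtain ⟨N, hN⟩ := Y.2
      refine ⟨max M N, fun X hX => ?_⟩
      rcases hX with rfl | hX
      · exact hN.mono hc (le_max_right _ _)
      · exact (hM X hX).mono hc (le_max_left _ _)
  obtain ⟨M, hM⟩ := h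
  exact ⟨M, fun X hX => hX (termUniform hc M) hM⟩

/-! ### Generation by atoms -/

theorem generatedBy_atoms [Finite D] :
    GeneratedBy (termAlgebra hc) {b : termAlgebra hc | IsAtom b} := by
  classical
  have : Finite K := Nat.finite_of_card_ne_zero (by have := hK.out; omega)
  intro X S hS
  let P : SplitAlgebra hc → Prop := fun Y => ∃ h : Y ∈ termAlgebra hc, ⟨Y, h⟩ ∈ S
  have hsup : ∀ Y Z, P Y → P Z → P (Y ⊔ Z) := fun Y Z ⟨_, h₂⟩ ⟨_, h₄⟩ =>
    ⟨_, S.supClosed' h₂ h₄⟩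
  have hinf : ∀ Y Z, P Y → P Z → P (Y ⊓ Z) := fun Y Z ⟨_, h₂⟩ ⟨_, h₄⟩ =>
    ⟨_, S.infClosed' h₂ h₄⟩
  have hcompl : ∀ Y, P Y → P Yᶜ := fun Y ⟨_, h₂⟩ => ⟨_, S.compl_mem' h₂⟩
  have hcomp : ∀ Y Z, P Y → P Z → P (Y ⨾ Z) := fun Y Z ⟨_, h₂⟩ ⟨_, h₄⟩ =>
    ⟨_, S.comp_mem' _ _ h₂ h₄⟩
  have hbot : P ⊥ := ⟨_, S.bot_mem'⟩
  have hsingle : ∀ p, P (single p) := fun p => ⟨_, hS (isAtom_termSingle hc p)⟩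
  have hfin : ∀ s : Set (Option (SplitAtom c)), s.Finite → P s := fun s hs => by
    induction s, hs using Set.Finite.induction_on with
    | empty => exact hbot
    | @insert p s _ _ ih => exact hsup _ _ (hsingle p) ih
  obtain ⟨N, hN⟩ := X.2
  obtain ⟨M, hM1, hXM⟩ : ∃ M, 1 ≤ M ∧ UniformBeyond M X.1 :=
    ⟨max 1 N, le_max_left _ _, hN.mono hc (le_max_right _ _)⟩
  have hlow := hfin _ (finite_lowAtoms (hK := hK) c M)
  -- The product of two distinct atoms of index `0` with `a` as the only common color of their blurs
  -- contains, beyond index `0`, exactly the atoms whose blur omits `a`.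
  have hstar : ∀ a : K, ∃ Y, P Y ∧ ∀ p : SplitAtom c, M ≤ p.idx →
      (some p ∈ Y ↔ a ∈ p.blur.1) := fun a => by
    obtain ⟨V, W, haV, haW, hVW, h⟩ := exists_blur_pair hK.out a
    obtain ⟨x, rfl⟩ := hc a
    let p : SplitAtom c := ⟨x, 0, V, haV⟩
    let q : SplitAtom c := ⟨x, 0, W, haW⟩
    refine ⟨(single (some p) ⨾ single (some q))ᶜ,
      hcompl _ (hcomp _ _ (hsingle _) (hsingle _)), fun r hr => ?_⟩
    have hiff : some r ∈ (single (some p) ⨾ single (some q) : SplitAlgebra hc) ↔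
        (splitTriples hc).tri p q r :=
      ⟨fun ⟨_, h₁, _, h₂, h₃⟩ => by rwa [h₁, h₂] at h₃, fun h => ⟨_, rfl, _, rfl, h⟩⟩
    rw [mem_compl, hiff, splitTriples_tri]
    constructor
    · intro h'
      by_contra har
      exact h' (Or.inl fun k hk₁ hk₂ hk₃ => har (h k hk₁ hk₂ ▸ hk₃))
    · rintro har (h' | ⟨⟨-, -, h'⟩, -⟩)
      · exact h' _ haV haW har
      · simp only [p, q] at h'
        omega
  have htail : ∀ W, P (tail hc W M) := fun W => by
    obtain ⟨a, b, hab, hW⟩ := Finset.card_eq_two.1 W.2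
    obtain ⟨Y, hY, hYa⟩ := hstar a
    obtain ⟨Z, hZ, hZb⟩ := hstar b
    have : tail hc W M = (Y ⊓ Z) ⊓ (show SplitAlgebra hc from lowAtoms c M)ᶜ := by
      ext z
      by_cases hz : z ∈ lowAtoms c M
      · refine iff_of_false ?_ fun h => h.2 hz
        rintro ⟨p, rfl, -, h⟩
        exact absurd (hz p rfl) (by omega)
      · obtain ⟨p, rfl, hp⟩ : ∃ p, z = some p ∧ M ≤ p.idx := by
          simpa [lowAtoms] using hz
        rw [mem_inf, mem_inf, hYa p hp, hZb p hp, some_mem_tail]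
        constructor
        · rintro ⟨rfl, -⟩
          exact ⟨⟨by simp [hW], by simp [hW]⟩, hz⟩
        · rintro ⟨⟨ha, hb⟩, -⟩
          refine ⟨Subtype.ext (Finset.eq_of_subset_of_card_le ?_ ?_).symm, hp⟩
          · rw [hW]
            intro k hk
            simp only [Finset.mem_insert, Finset.mem_singleton] at hk
            rcases hk with rfl | rfl <;> assumption
          · rw [W.2, p.blur.2]
    rw [this]
    exact hinf _ _ (hinf _ _ hY hZ) (hcompl _ hlow)
  have htails : ∀ s : Set (Blur K), P ({z | ∃ W ∈ s, z ∈ tail hc W M} : Set _) := fun s => by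
    induction s, s.toFinite using Set.Finite.induction_on with
    | empty => simpa using (show P (∅ : Set (Option (SplitAtom c))) from hbot)
    | @insert W s _ _ ih =>
      refine (congrArg P (Set.ext fun z => ?_)).mpr (hsup _ _ (htail W) ih)
      exact ⟨fun ⟨V, hV, h⟩ => hV.elim (fun h' => Or.inl (h' ▸ h)) fun h' => Or.inr ⟨V, h', h⟩,
        fun h => h.elim (fun h' => ⟨W, Or.inl rfl, h'⟩)
          fun ⟨V, hV, h'⟩ => ⟨V, Or.inr hV, h'⟩⟩
  have hX : X.1 = (show SplitAlgebra hc from ({z | z ∈ X.1 ∧ z ∈ lowAtoms c M} : Set _)) ⊔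
      (show SplitAlgebra hc from
        ({z | ∃ W ∈ {W | tail hc W M ≤ X.1}, z ∈ tail hc W M} : Set _)) := by
    ext z
    by_cases hz : z ∈ lowAtoms c M
    · refine ⟨fun h => Or.inl ⟨h, hz⟩, fun h => h.elim And.left ?_⟩
      rintro ⟨W, hW, h⟩
      exact hW h
    · refine ⟨fun h => Or.inr ?_, fun h => h.elim And.left ?_⟩
      · obtain ⟨p, rfl, hp⟩ : ∃ p, z = some p ∧ M ≤ p.idx := by
          simpa [lowAtoms] using hz
        refine ⟨p.blur, ?_, (some_mem_tail hc).2 ⟨rfl, hp⟩⟩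
        rintro _ ⟨q, rfl, hq, hqM⟩
        exact hXM p q hq.symm hp hqM h
      · rintro ⟨W, hW, h⟩
        exact hW h
  have := hsup _ _ (hfin {z | z ∈ X.1 ∧ z ∈ lowAtoms c M}
    ((finite_lowAtoms (hK := hK) c M).subset fun _ h => h.2)) (htails {W | tail hc W M ≤ X.1})
  obtain ⟨h₁, h₂⟩ := this
  have hX' : X = ⟨_, h₁⟩ := Subtype.ext hX
  rw [hX']
  exact h₂

end RelationAlgebra

namespace RelationAlgebra

open BlurredTriples SetAlgebra

/-! ### Arithmetic of symmetric integral relation algebras -/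

section Arithmetic

variable {A : Type u} [RelationAlgebra A]

theorem IsSymmetric.comp_comm (h : IsSymmetric A) (x y : A) : x ⨾ y = y ⨾ x := by
  rw [← h (x ⨾ y), conv_comp, h, h]

theorem IsSymmetric.ident_comp (h : IsSymmetric A) (x : A) : RelOps.ident ⨾ x = x := by
  rw [h.comp_comm, comp_ident]

theorem comp_mono_left {x y : A} (h : x ≤ y) (z : A) : x ⨾ z ≤ y ⨾ z := by
  rw [← sup_eq_right.2 h, sup_comp]
  exact le_sup_left

theorem IsSymmetric.comp_mono (h : IsSymmetric A) {x y z w : A} (h₁ : x ≤ y) (h₂ : z ≤ w) :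
    x ⨾ z ≤ y ⨾ w := by
  refine (comp_mono_left h₁ z).trans ?_
  rw [h.comp_comm, h.comp_comm y]
  exact comp_mono_left h₂ y

theorem IsSymmetric.comp_bot (h : IsSymmetric A) (x : A) : x ⨾ ⊥ = ⊥ := by
  have h₁ := conv_comp_compl x (⊤ : A)
  rw [h, compl_top] at h₁
  exact le_bot_iff.1 ((h.comp_mono le_rfl bot_le).trans h₁)

/-- The cycle law for symmetric algebras. -/
theorem IsSymmetric.le_comp_of_le_comp (h : IsSymmetric A) {x y z : A} (hy : IsAtom y)
    (hz : z ≠ ⊥) (hxy : z ≤ x ⨾ y) : y ≤ x ⨾ z := by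
  by_contra hn
  have h₁ : y ≤ (x ⨾ z)ᶜ :=
    le_compl_iff_disjoint_right.2 (hy.not_le_iff_disjoint.1 hn)
  have h₂ := conv_comp_compl x z
  rw [h] at h₂
  have h₃ : z ≤ zᶜ := hxy.trans ((h.comp_mono le_rfl h₁).trans h₂)
  exact hz (le_compl_self.1 h₃)

theorem IsIntegral.isAtom_ident (hs : IsSymmetric A) (h : IsIntegral A) :
    IsAtom (RelOps.ident : A) := by
  obtain ⟨hne, h⟩ := h
  have hbot : (RelOps.ident : A) ≠ ⊥ := fun h' => by
    have := comp_ident (⊤ : A)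
    rw [h', hs.comp_bot] at this
    exact bot_ne_top this
  refine ⟨hbot, fun x hx => ?_⟩
  -- A part of the identity element and its relative complement have zero product.
  have hy : RelOps.ident \ x ≤ (RelOps.ident : A) := sdiff_le
  have h₁ : x ⨾ (RelOps.ident \ x) ≤ x := by
    conv_rhs => rw [← comp_ident x]
    exact hs.comp_mono le_rfl hy
  have h₂ : x ⨾ (RelOps.ident \ x) ≤ RelOps.ident \ x := by
    conv_rhs => rw [← hs.ident_comp (RelOps.ident \ x)]
    exact hs.comp_mono hx.le le_rfl
  have h₃ : x ⨾ (RelOps.ident \ x) = ⊥ :=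
    le_bot_iff.1 ((le_inf h₁ h₂).trans_eq inf_sdiff_self_right)
  rcases h _ _ h₃ with h' | h'
  · exact h'
  · exact absurd (sdiff_eq_bot_iff.1 h') hx.not_ge

theorem IsDiversityAtom.ne_ident (hi : (RelOps.ident : A) ≠ ⊥) {x : A}
    (hx : IsDiversityAtom x) : x ≠ RelOps.ident := fun h =>
  hi (le_compl_self.1 (h ▸ hx.2 : (RelOps.ident : A) ≤ RelOps.identᶜ))

theorem isDiversityAtom_of_ne (hi : IsAtom (RelOps.ident : A)) {x : A} (hx : IsAtom x)
    (h : x ≠ RelOps.ident) : IsDiversityAtom x := by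
  refine ⟨hx, le_compl_iff_disjoint_right.2 (hx.not_le_iff_disjoint.1 fun h' => ?_)⟩
  rcases hi.le_iff.1 h' with h₁ | h₁
  · exact hx.1 h₁
  · exact h h₁

/-! ### The one-point extension property -/

/-- A system of blurred triples with big atoms on the diversity atoms of an algebra yields the
one-point extension property. -/
theorem onePointExtensionProperty_of_isBig {K : Type u} (hK : 6 ≤ Nat.card K) (hs : IsSymmetric A)
    (hi : IsAtom (RelOps.ident : A)) (S : BlurredTriples K {x : A // IsDiversityAtom x})
    (hS : ∀ x y z, S.tri x y z ↔ z.1 ≤ x.1 ⨾ y.1) {big : Blur K → {x : A // IsDiversityAtom x}}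
    (hbig : S.IsBig big) : OnePointExtensionProperty A := by
  classical
  intro k μ x y i j hμ hid hx hy hij hxy
  have hμs : ∀ l m, μ l m = μ m l := fun l m => by rw [← hμ.conv, hs]
  have hdiag : ∀ l, μ l l = RelOps.ident := fun l => (hid l l).2 rfl
  have hdiv : ∀ l m, l ≠ m → IsDiversityAtom (μ l m) := fun l m h =>
    isDiversityAtom_of_ne hi (hμ.atom l m) fun h' => h ((hid l m).1 h')
  let ν : Fin k → Fin k → {x : A // IsDiversityAtom x} := fun l m =>
    if h : l ≠ m then ⟨μ l m, hdiv l m h⟩ else ⟨x, hx⟩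
  have hν : ∀ l m, l ≠ m → (ν l m).1 = μ l m := fun l m h => by simp [ν, h]
  have hνs : ∀ l m, ν l m = ν m l := fun l m => by
    by_cases h : l = m
    · rw [h]
    · exact Subtype.ext (by rw [hν l m h, hν m l (Ne.symm h), hμs])
  obtain ⟨r, hri, hrj, hr⟩ := S.exists_row hK hbig ν hνs i j ⟨x, hx⟩ ⟨y, hy⟩
    (Or.inr ⟨hij, by rw [hS, hν i j hij]; exact hxy⟩)
  have hself : ∀ l, RelOps.ident ≤ (r l).1 ⨾ (r l).1 := fun l =>
    hs.le_comp_of_le_comp hi (r l).2.1.1 (by rw [comp_ident])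
  have hcomp : ∀ l m, μ l m ≤ (r l).1 ⨾ (r m).1 := fun l m => by
    by_cases h : l = m
    · rw [h, hdiag]
      exact hself m
    · rw [← hν l m h, ← hS]
      exact hr l m h
  have hcomp' : ∀ l m, (r l).1 ≤ (r m).1 ⨾ μ l m := fun l m =>
    hs.le_comp_of_le_comp (r l).2.1 (hμ.atom l m).1 (by
      rw [hs.comp_comm]
      exact hcomp l m)
  let μ' : Fin (k + 1) → Fin (k + 1) → A := fun a b =>
    Fin.lastCases (motive := fun _ => A)
      (Fin.lastCases (motive := fun _ => A) RelOps.ident (fun m => (r m).1) b)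
      (fun l => Fin.lastCases (motive := fun _ => A) (r l).1 (fun m => μ l m) b) a
  have h₀ : μ' (Fin.last k) (Fin.last k) = RelOps.ident := by simp [μ']
  have h₁ : ∀ m : Fin k, μ' (Fin.last k) m.castSucc = (r m).1 := fun m => by simp [μ']
  have h₂ : ∀ l : Fin k, μ' l.castSucc (Fin.last k) = (r l).1 := fun l => by simp [μ']
  have h₃ : ∀ l m : Fin k, μ' l.castSucc m.castSucc = μ l m := fun l m => by simp [μ']
  refine ⟨μ', ⟨fun a b => ?_, fun a => ?_, fun a b => ?_, fun a b d => ?_⟩, fun a b => ?_, h₃, ?_, ?_⟩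
  · induction a using Fin.lastCases <;> induction b using Fin.lastCases
    · rw [h₀]; exact hi
    · rw [h₁]; exact (r _).2.1
    · rw [h₂]; exact (r _).2.1
    · rw [h₃]; exact hμ.atom _ _
  · induction a using Fin.lastCases
    · rw [h₀]
    · rw [h₃]; exact hμ.diag _
  · rw [hs]
    induction a using Fin.lastCases <;> induction b using Fin.lastCases
    · rfl
    · rw [h₁, h₂]
    · rw [h₁, h₂]
    · rw [h₃, h₃]; exact hμs _ _
  · induction a using Fin.lastCases <;> induction b using Fin.lastCases <;>
      induction d using Fin.lastCases
    · rw [h₀, comp_ident]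
    · rw [h₀, h₁, h₂]; exact hself _
    · rw [h₀, h₁, hs.ident_comp]
    · rw [h₁, h₁, h₃, hμs]; exact hcomp' _ _
    · rw [h₀, h₂, comp_ident]
    · rw [h₂, h₂, h₃, hs.comp_comm]; exact hcomp' _ _
    · rw [h₁, h₂, h₃]; exact hcomp _ _
    · rw [h₃, h₃, h₃]; exact hμ.comp _ _ _
  · induction a using Fin.lastCases with
    | last =>
      induction b using Fin.lastCases with
      | last => exact iff_of_true h₀ rfl
      | cast m =>
        rw [h₁]
        exact iff_of_false ((r m).2.ne_ident hi.1) (Fin.castSucc_lt_last m).ne'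
    | cast l =>
      induction b using Fin.lastCases with
      | last =>
        rw [h₂]
        exact iff_of_false ((r l).2.ne_ident hi.1) (Fin.castSucc_lt_last l).ne
      | cast m => rw [h₃, hid, Fin.castSucc_inj]
  · rw [h₂, hri]
  · rw [h₁, hrj]

end Arithmetic

variable {D K : Type u} {c : D → K} (hc : Function.Surjective c) [hK : Fact (6 ≤ Nat.card K)]

theorem splitAlgebra_isSymmetric : IsSymmetric (SplitAlgebra hc) := isSymmetric

theorem termUniform_isAtom_ident (M : ℕ) : IsAtom (RelOps.ident : termUniform hc M) :=
  IsIntegral.isAtom_ident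
    (Subalgebra.isSymmetric (Subalgebra.isSymmetric (splitAlgebra_isSymmetric hc) _) _)
    (Subalgebra.isIntegral (Subalgebra.isIntegral (splitAlgebra_isIntegral hc) _) _)

/-- The tail at index `M` as an element of the finite subalgebra that does not split it. -/
def termTail (M : ℕ) (W : Blur K) : termUniform hc M :=
  ⟨⟨tail hc W M, M, uniformBeyond_tail hc W le_rfl⟩, uniformBeyond_tail hc W le_rfl⟩

theorem termTail_isDiversityAtom (M : ℕ) (W : Blur K) : IsDiversityAtom (termTail hc M W) := by
  obtain ⟨p, hp⟩ := exists_mem_tail hc W M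
  refine ⟨⟨fun h => ?_, fun X hX => ?_⟩, ?_⟩
  · have : (tail hc W M : SplitAlgebra hc) = ⊥ := Subtype.ext_iff.1 (Subtype.ext_iff.1 h)
    rw [this] at hp
    exact hp
  · have hXle : X.1.1 ≤ tail hc W M := hX.le
    rcases eq_bot_or_exists_mem X.1.1 with h | ⟨q, hq⟩
    · exact Subtype.ext (Subtype.ext h)
    · obtain ⟨q, rfl, hqW, hqM⟩ := hXle hq
      refine absurd (show termTail hc M W ≤ X from ?_) hX.not_ge
      rintro _ ⟨r, rfl, hrW, hrM⟩
      exact X.2 q r (hqW.trans hrW.symm) hqM hrM hq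
  · rintro _ ⟨q, rfl, -, -⟩ h
    exact Option.some_ne_none q h

theorem exists_blur_of_isDiversityAtom {M : ℕ} {X : termUniform hc M} (hX : IsDiversityAtom X) :
    (∃ p, p ∈ X.1.1) ∧ ∃ W : Blur K, ∀ z ∈ X.1.1, ∃ p, z = some p ∧ p.blur = W := by
  have hne : ∃ p, p ∈ X.1.1 := by
    rcases eq_bot_or_exists_mem X.1.1 with h | h
    · exact absurd (Subtype.ext (Subtype.ext h)) hX.1.1
    · exact h
  refine ⟨hne, ?_⟩
  obtain ⟨z, hz⟩ := hne
  rcases z with _ | p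
  · exact absurd rfl (hX.2 hz)
  let Y : termUniform hc M := ⟨⟨tail hc p.blur 0, M, uniformBeyond_tail hc _ (Nat.zero_le M)⟩,
    uniformBeyond_tail hc _ (Nat.zero_le M)⟩
  have hXY : X ≤ Y := by
    by_contra h
    have h₁ : X ⊓ Y = ⊥ := disjoint_iff.1 (hX.1.not_le_iff_disjoint.1 h)
    have h₂ : X.1.1 ⊓ Y.1.1 = ⊥ := Subtype.ext_iff.1 (Subtype.ext_iff.1 h₁)
    have h₃ : some p ∈ X.1.1 ⊓ Y.1.1 := ⟨hz, (some_mem_tail hc).2 ⟨rfl, Nat.zero_le _⟩⟩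
    rw [h₂] at h₃
    exact h₃
  exact ⟨p.blur, fun z hz => by
    obtain ⟨q, rfl, hq, -⟩ := hXY hz
    exact ⟨q, rfl, hq⟩⟩

theorem termUniform_onePointExtensionProperty (M : ℕ) :
    OnePointExtensionProperty (termUniform hc M) := by
  have hs := Subalgebra.isSymmetric (Subalgebra.isSymmetric (splitAlgebra_isSymmetric hc)
    (termAlgebra hc)) (termUniform hc M)
  choose hne blur hblur using fun X : {X : termUniform hc M // IsDiversityAtom X} =>
    exists_blur_of_isDiversityAtom hc X.2
  have hbig : ∀ W, blur ⟨termTail hc M W, termTail_isDiversityAtom hc M W⟩ = W := fun W => by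
    obtain ⟨p, hp⟩ := exists_mem_tail hc W M
    obtain ⟨q, hq, hqW⟩ := hblur ⟨termTail hc M W, termTail_isDiversityAtom hc M W⟩ (some p) hp
    obtain rfl := Option.some.inj hq
    exact hqW.symm.trans ((some_mem_tail hc).1 hp).1
  let S : BlurredTriples K {X : termUniform hc M // IsDiversityAtom X} :=
    { tri := fun X Y Z => Z.1 ≤ X.1 ⨾ Y.1
      blur := blur
      tri_swap := fun {X Y Z} h => by rwa [hs.comp_comm]
      tri_rot := fun {X Y Z} h => hs.le_comp_of_le_comp X.2.1 Z.2.1.1 (by rwa [hs.comp_comm])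
      blur_surjective := fun W => ⟨_, hbig W⟩
      tri_of_noCommonColor := fun {X Y Z} h => by
        intro z hz
        obtain ⟨p, hp⟩ := hne X
        obtain ⟨q, hq⟩ := hne Y
        obtain ⟨p, rfl, hpX⟩ := hblur X p hp
        obtain ⟨q, rfl, hqY⟩ := hblur Y q hq
        obtain ⟨r, rfl, hrZ⟩ := hblur Z z hz
        refine ⟨some p, hp, some q, hq, ?_⟩
        rw [cyc_some, splitTriples_tri, hpX, hqY, hrZ]
        exact Or.inl h }
  refine onePointExtensionProperty_of_isBig hK.out hs (termUniform_isAtom_ident hc M) S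
    (fun _ _ _ => Iff.rfl) (big := fun W => ⟨termTail hc M W, termTail_isDiversityAtom hc M W⟩)
    ⟨hbig, fun V W Z => ?_⟩
  intro z hz
  obtain ⟨r, rfl, -⟩ := hblur Z z hz
  obtain ⟨p, hpi, hpb, hpc⟩ := SplitAtom.exists_color_ne hc (max M r.idx) V (c r.base)
  obtain ⟨q, hqi, hqb⟩ := SplitAtom.exists_blur_eq hc (max M r.idx) W
  refine ⟨some p, (some_mem_tail hc).2 ⟨hpb, by omega⟩, some q,
    (some_mem_tail hc).2 ⟨hqb, by omega⟩, ?_⟩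
  rw [cyc_some, splitTriples_tri]
  exact Or.inr ⟨⟨by omega, by omega, by omega⟩, fun h => hpc h.1⟩

end RelationAlgebra

namespace RelationAlgebra

open BlurredTriples SetAlgebra

variable {D K : Type u} {c : D → K} {hc : Function.Surjective c}

/-! ### Representability of the term algebra -/

/-- The set of labels that correspond to the ultrafilters containing `X`: the limit label of a blur
belongs to it when `X` contains a tail. -/
def InLabels (X : SplitAlgebra hc) : Option (Label c) → Prop
  | none => none ∈ X
  | some (.inl p) => some p ∈ X
  | some (.inr W) => ∃ M, tail hc W M ≤ X

theorem inLabels_inr_of_mem {M : ℕ} {X : SplitAlgebra hc} (hX : UniformBeyond M X)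
    {p : SplitAtom c} (hM : M ≤ p.idx) (hp : some p ∈ X) : InLabels X (some (.inr p.blur)) := by
  refine ⟨M, ?_⟩
  rintro _ ⟨q, rfl, hq, hqM⟩
  exact hX p q hq.symm hM hqM hp

theorem exists_of_inLabels_inr {X : SplitAlgebra hc} {W : Blur K}
    (h : InLabels X (some (.inr W))) :
    ∃ M, ∀ n, M ≤ n → ∀ k, ∃ p : SplitAtom c, p.idx = n ∧ p.blur = W ∧ c p.base ≠ k ∧
      some p ∈ X := by
  obtain ⟨M, hM⟩ := h
  refine ⟨M, fun n hn k => ?_⟩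
  obtain ⟨p, h₁, h₂, h₃⟩ := SplitAtom.exists_color_ne hc n W k
  exact ⟨p, h₁, h₂, h₃, hM ((some_mem_tail hc).2 ⟨h₂, by omega⟩)⟩

theorem inLabels_sup {M : ℕ} {X Y : SplitAlgebra hc} (hX : UniformBeyond M X)
    (hY : UniformBeyond M Y) (z : Option (Label c)) :
    InLabels (X ⊔ Y) z ↔ InLabels X z ∨ InLabels Y z := by
  rcases z with _ | p | W
  · exact Iff.rfl
  · exact Iff.rfl
  · constructor
    · rintro ⟨N, hN⟩
      obtain ⟨p, hp, hpW⟩ := SplitAtom.exists_blur_eq hc (max M N) W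
      subst hpW
      rcases hN ((some_mem_tail hc).2 ⟨rfl, by omega⟩) with h | h
      · exact Or.inl (inLabels_inr_of_mem hX (by omega) h)
      · exact Or.inr (inLabels_inr_of_mem hY (by omega) h)
    · rintro (⟨N, hN⟩ | ⟨N, hN⟩)
      · exact ⟨N, hN.trans le_sup_left⟩
      · exact ⟨N, hN.trans le_sup_right⟩

theorem inLabels_compl {M : ℕ} {X : SplitAlgebra hc} (hX : UniformBeyond M X)
    (z : Option (Label c)) : InLabels Xᶜ z ↔ ¬ InLabels X z := by
  rcases z with _ | p | W
  · exact Iff.rfl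
  · exact Iff.rfl
  · constructor
    · rintro ⟨N, hN⟩ ⟨N', hN'⟩
      obtain ⟨p, hp, hpW⟩ := SplitAtom.exists_blur_eq hc (max N N') W
      exact hN ((some_mem_tail hc).2 ⟨hpW, by omega⟩)
        (hN' ((some_mem_tail hc).2 ⟨hpW, by omega⟩))
    · intro h
      refine ⟨M, ?_⟩
      rintro _ ⟨p, rfl, rfl, hp⟩ hpX
      exact h (inLabels_inr_of_mem hX hp hpX)

/-- A cycle of labels through `X` and `Y` is reflected in the product of `X` and `Y`, with the limit
labels replaced by atoms of large index. -/
theorem inLabels_comp_of_cyc {X Y : SplitAlgebra hc} {x y z : Option (Label c)}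
    (hx : InLabels X x) (hy : InLabels Y y) (h : (labelTriples c).cyc x y z) :
    InLabels (X ⨾ Y) z := by
  rcases x with _ | x
  · obtain rfl : y = z := h
    rcases y with _ | p | W
    · exact ⟨none, hx, none, hy, rfl⟩
    · exact ⟨none, hx, some p, hy, rfl⟩
    · obtain ⟨M, hM⟩ := hy
      exact ⟨M, fun r hr => ⟨none, hx, r, hM hr, rfl⟩⟩
  rcases y with _ | y
  · obtain rfl : some x = z := h
    rcases x with p | W
    · exact ⟨some p, hx, none, hy, by simp⟩
    · obtain ⟨M, hM⟩ := hx
      exact ⟨M, fun r hr => ⟨r, hM hr, none, hy, by simp⟩⟩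
  rcases z with _ | z
  · rw [cyc_none_right] at h
    obtain rfl := Option.some.inj h
    rcases x with p | W
    · exact ⟨some p, hx, some p, hy, by simp⟩
    · obtain ⟨M, hM⟩ := hx
      obtain ⟨N, hN⟩ := hy
      obtain ⟨p, hp, hpW⟩ := SplitAtom.exists_blur_eq hc (max M N) W
      exact ⟨some p, hM ((some_mem_tail hc).2 ⟨hpW, by omega⟩), some p,
        hN ((some_mem_tail hc).2 ⟨hpW, by omega⟩), by simp⟩
  change Label.Tri x y z at h
  rcases x with p | V <;> rcases y with q | W
  · rcases z with r | U
    · exact ⟨some p, hx, some q, hy, h⟩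
    · rw [Label.tri_inr] at h
      refine ⟨0, ?_⟩
      rintro _ ⟨r, rfl, rfl, -⟩
      exact ⟨some p, hx, some q, hy, Or.inl h⟩
  · obtain ⟨N, hN⟩ := exists_of_inLabels_inr hy
    rcases z with r | U
    · have h' : NoCommonColor p.blur W r.blur := fun k hp hW hr =>
        Label.tri_inr.1 h.rot.rot k hr hp hW
      obtain ⟨q, -, rfl, -, hq⟩ := hN N le_rfl (c p.base)
      exact ⟨some p, hx, some q, hq, Or.inl h'⟩
    · refine ⟨max N p.idx, ?_⟩
      rintro _ ⟨r, rfl, rfl, hr⟩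
      obtain ⟨q, hqi, hqb, hqc, hq⟩ := hN r.idx (by omega) (c r.base)
      refine ⟨some p, hx, some q, hq, ?_⟩
      rw [cyc_some, splitTriples_tri]
      exact Or.inr ⟨⟨by omega, by omega, by omega⟩, fun h => hqc h.2⟩
  · obtain ⟨N, hN⟩ := exists_of_inLabels_inr hx
    rcases z with r | U
    · have h' : NoCommonColor V q.blur r.blur := fun k hV hq hr =>
        Label.tri_inr.1 h.rot k hq hr hV
      obtain ⟨p, -, rfl, -, hp⟩ := hN N le_rfl (c q.base)
      exact ⟨some p, hp, some q, hy, Or.inl h'⟩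
    · refine ⟨max N q.idx, ?_⟩
      rintro _ ⟨r, rfl, rfl, hr⟩
      obtain ⟨p, hpi, hpb, hpc, hp⟩ := hN r.idx (by omega) (c r.base)
      refine ⟨some p, hp, some q, hy, ?_⟩
      rw [cyc_some, splitTriples_tri]
      exact Or.inr ⟨⟨by omega, by omega, by omega⟩, fun h => hpc h.1⟩
  · obtain ⟨M, hM⟩ := exists_of_inLabels_inr hx
    obtain ⟨N, hN⟩ := exists_of_inLabels_inr hy
    have key : ∀ r : SplitAtom c, some r ∈ X ⨾ Y := fun r => by
      obtain ⟨p, hpi, hpb, hpc, hp⟩ := hM (max r.idx (max M N)) (by omega) (c r.base)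
      obtain ⟨q, hqi, hqb, hqc, hq⟩ := hN (max r.idx (max M N)) (by omega) (c r.base)
      refine ⟨some p, hp, some q, hq, ?_⟩
      rw [cyc_some, splitTriples_tri]
      exact Or.inr ⟨⟨by omega, by omega, by omega⟩, fun h => hpc h.1⟩
    rcases z with r | U
    · exact key r
    · refine ⟨0, ?_⟩
      rintro _ ⟨r, rfl, -⟩
      exact key r

theorem exists_cyc_of_inLabels_comp {M : ℕ} {X Y : SplitAlgebra hc} (hX : UniformBeyond M X)
    (hY : UniformBeyond M Y) {z : Option (Label c)} (h : InLabels (X ⨾ Y) z) :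
    ∃ x y, InLabels X x ∧ InLabels Y y ∧ (labelTriples c).cyc x y z := by
  rcases z with _ | r | W
  · obtain ⟨x, hx, y, hy, h⟩ := h
    rw [cyc_none_right] at h
    subst h
    rcases x with _ | p
    · exact ⟨none, none, hx, hy, rfl⟩
    · exact ⟨some (.inl p), some (.inl p), hx, hy, by simp⟩
  · obtain ⟨x, hx, y, hy, h⟩ := h
    rcases x with _ | p
    · obtain rfl : y = some r := h
      exact ⟨none, some (.inl r), hx, hy, rfl⟩
    rcases y with _ | q
    · obtain rfl : p = r := Option.some.inj h
      exact ⟨some (.inl p), none, hx, hy, by simp⟩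
    exact ⟨some (.inl p), some (.inl q), hx, hy, h⟩
  · obtain ⟨N, hN⟩ := h
    obtain ⟨r, hri, rfl⟩ := SplitAtom.exists_blur_eq hc (max M N) W
    obtain ⟨x, hx, y, hy, h⟩ := hN ((some_mem_tail hc).2 ⟨rfl, by omega⟩)
    rcases x with _ | p
    · obtain rfl : y = some r := h
      exact ⟨none, some (.inr r.blur), hx, inLabels_inr_of_mem hY (by omega) hy, rfl⟩
    rcases y with _ | q
    · obtain rfl : p = r := Option.some.inj h
      exact ⟨some (.inr p.blur), none, inLabels_inr_of_mem hX (by omega) hx, hy, by simp⟩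
    -- A factor of index at least `M` is replaced by a limit label. If both indices are smaller,
    -- the cycle can only come from the blurs.
    by_cases hp : p.idx < M <;> by_cases hq : q.idx < M
    · refine ⟨some (.inl p), some (.inl q), hx, hy, Label.tri_inr.2 ?_⟩
      rw [cyc_some, splitTriples_tri] at h
      rcases h with h | ⟨⟨-, -, h⟩, -⟩
      · exact h
      · omega
    · exact ⟨some (.inl p), some (.inr q.blur), hx, inLabels_inr_of_mem hY (by omega) hy,
        Label.tri_inr_inr _ _ _⟩
    · exact ⟨some (.inr p.blur), some (.inl q), inLabels_inr_of_mem hX (by omega) hx, hy,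
        (Label.tri_inr_inr _ _ _).swap⟩
    · exact ⟨some (.inr p.blur), some (.inr q.blur), inLabels_inr_of_mem hX (by omega) hx,
        inLabels_inr_of_mem hY (by omega) hy, Label.tri_inr_inr _ _ _⟩

variable (hc) [hK : Fact (6 ≤ Nat.card K)]

theorem isRepresentable_termAlgebra [Finite D] : IsRepresentable (termAlgebra hc) := by
  classical
  have : Finite K := Nat.finite_of_card_ne_zero (by have := hK.out; omega)
  have : Countable (SplitAtom c) := Function.Injective.countable
    (f := fun p : SplitAtom c => (p.base, p.idx, p.blur)) (by
      rintro ⟨x, i, W, hW⟩ ⟨y, j, V, hV⟩ h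
      simp only [Prod.mk.injEq] at h
      obtain ⟨rfl, rfl, rfl⟩ := h
      rfl)
  obtain ⟨N, hsymm, htri, hwit⟩ := (labelTriples c).exists_network hK.out labelTriples_isBig
  let L : ℕ → ℕ → Option (Label c) := fun i j => if i = j then none else some (N i j)
  have hLd : ∀ i, L i i = none := fun i => by simp [L]
  have hLne : ∀ i j, i ≠ j → L i j = some (N i j) := fun i j h => by simp [L, h]
  have hLnone : ∀ i j, L i j = none ↔ i = j := fun i j => by simp [L]
  have hLsymm : ∀ i j, L i j = L j i := fun i j => by
    by_cases h : i = j
    · rw [h]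
    · rw [hLne i j h, hLne j i (Ne.symm h), hsymm]
  have hLcyc : ∀ i l j, (labelTriples c).cyc (L i l) (L l j) (L i j) := fun i l j => by
    by_cases hil : i = l
    · subst hil
      rw [hLd, cyc_none_left]
    by_cases hlj : l = j
    · subst hlj
      rw [hLd, cyc_none_mid]
    by_cases hij : i = j
    · subst hij
      rw [hLd, cyc_none_right, hLsymm]
    rw [hLne i l hil, hLne l j hlj, hLne i j hij, cyc_some]
    exact htri i j l hil hlj hij
  have hLwit : ∀ i j x y, (labelTriples c).cyc x y (L i j) → ∃ l, L i l = x ∧ L l j = y := by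
    intro i j x y h
    rcases x with _ | x
    · exact ⟨i, hLd i, h.symm⟩
    rcases y with _ | y
    · rw [cyc_none_mid] at h
      exact ⟨j, h.symm, hLd j⟩
    by_cases hij : i = j
    · subst hij
      rw [hLd, cyc_none_right] at h
      obtain ⟨l, hl, -, h₁, h₂⟩ := hwit i i x y (Or.inl ⟨rfl, Option.some.inj h⟩)
      exact ⟨l, by rw [hLne i l hl.symm, h₁], by rw [hLne l i hl, h₂]⟩
    · rw [hLne i j hij] at h
      obtain ⟨l, hli, hlj, h₁, h₂⟩ := hwit i j x y (Or.inr ⟨hij, h⟩)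
      exact ⟨l, by rw [hLne i l hli.symm, h₁], by rw [hLne l j hlj, h₂]⟩
  let ρ : termAlgebra hc → Set (ULift.{u} ℕ × ULift.{u} ℕ) :=
    fun X => {s | InLabels X.1 (L s.1.down s.2.down)}
  have htop : ∀ s, s ∈ ρ ⊤ := fun s => by
    change InLabels _ _
    rcases L s.1.down s.2.down with _ | p | W
    · exact mem_top
    · exact mem_top
    · exact ⟨0, fun _ _ => mem_top⟩
  have hle : ∀ X Y, ρ X ⊆ ρ Y → X ≤ Y := fun X Y h p hp => by
    rcases p with _ | p
    · have : InLabels X.1 (L 0 0) := by rw [hLd]; exact hp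
      have h' : InLabels Y.1 (L 0 0) :=
        h (show ((⟨0⟩, ⟨0⟩) : ULift.{u} ℕ × ULift.{u} ℕ) ∈ ρ X from this)
      rw [hLd] at h'
      exact h'
    · obtain ⟨l, h₁, -⟩ := hLwit 0 0 (some (.inl p)) (some (.inl p)) (by rw [hLd]; simp)
      have : InLabels X.1 (L 0 l) := by rw [h₁]; exact hp
      have h' : InLabels Y.1 (L 0 l) :=
        h (show ((⟨0⟩, ⟨l⟩) : ULift.{u} ℕ × ULift.{u} ℕ) ∈ ρ X from this)
      rw [h₁] at h'
      exact h'
  have hunif : ∀ X Y : termAlgebra hc, ∃ M, UniformBeyond M X.1 ∧ UniformBeyond M Y.1 := by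
    rintro ⟨X, M, hX⟩ ⟨Y, N, hY⟩
    exact ⟨max M N, hX.mono hc (le_max_left _ _), hY.mono hc (le_max_right _ _)⟩
  refine ⟨ULift.{u} ℕ, ρ, ?_, ⟨fun _ => htop _, fun _ => htop _, fun _ _ => htop _⟩, fun X Y => ?_,
    fun X => ?_, fun X Y => ?_, fun X => ?_, ?_⟩
  · exact fun X Y h => le_antisymm (hle X Y h.subset) (hle Y X h.superset)
  · obtain ⟨M, hX, hY⟩ := hunif X Y
    ext s
    exact inLabels_sup hX hY _
  · obtain ⟨M, hX, -⟩ := hunif X X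
    ext s
    exact (inLabels_compl hX _).trans ⟨fun h => ⟨htop s, h⟩, fun h => h.2⟩
  · obtain ⟨M, hX, hY⟩ := hunif X Y
    ext s
    constructor
    · intro h
      obtain ⟨x, y, hx, hy, h⟩ := exists_cyc_of_inLabels_comp hX hY h
      obtain ⟨l, rfl, rfl⟩ := hLwit _ _ _ _ h
      exact ⟨⟨l⟩, hx, hy⟩
    · rintro ⟨l, hx, hy⟩
      exact inLabels_comp_of_cyc hx hy (hLcyc _ _ _)
  · ext s
    change InLabels X.1 _ ↔ InLabels X.1 _
    rw [hLsymm]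
  · ext s
    change InLabels (RelOps.ident : SplitAlgebra hc) (L s.1.down s.2.down) ↔ s.1 = s.2
    rw [ULift.ext_iff, ← hLnone]
    rcases L s.1.down s.2.down with _ | p | W
    · exact iff_of_true rfl rfl
    · exact iff_of_false (Option.some_ne_none _) (Option.some_ne_none _)
    · refine iff_of_false ?_ (Option.some_ne_none _)
      rintro ⟨M, hM⟩
      obtain ⟨p, hp⟩ := exists_mem_tail hc W M
      exact Option.some_ne_none _ (hM hp)

/-! ### Monochromatic triangles -/

/-- A set of points whose pairs are colored with finitely many colors, without monochromatic
triangles, is finite. -/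
theorem finite_of_no_monochromatic {V : Type v} {K : Type u} (col : V → V → K) (F : Finset K) :
    ∀ s : Set V, (∀ x ∈ s, ∀ y ∈ s, x ≠ y → col x y ∈ F) →
      (∀ x ∈ s, ∀ y ∈ s, ∀ z ∈ s, x ≠ y → y ≠ z → x ≠ z →
        ¬ (col x y = col x z ∧ col y z = col x z)) → s.Finite := by
  classical
  induction F using Finset.strongInduction with
  | H F ih =>
    intro s hs hmono
    rcases s.eq_empty_or_nonempty with rfl | ⟨v, hv⟩
    · exact Set.finite_empty
    -- The neighbours of `v` in a color `k` span no edge of color `k`.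
    have hfin : ∀ k ∈ F, {w ∈ s | w ≠ v ∧ col v w = k}.Finite := fun k hk => by
      refine ih (F.erase k) (Finset.erase_ssubset hk) _ (fun x hx y hy hxy => ?_)
        fun x hx y hy z hz => hmono x hx.1 y hy.1 z hz.1
      refine Finset.mem_erase.2 ⟨fun h => ?_, hs x hx.1 y hy.1 hxy⟩
      exact hmono v hv x hx.1 y hy.1 hx.2.1.symm hxy hy.2.1.symm
        ⟨hx.2.2.trans hy.2.2.symm, h.trans hy.2.2.symm⟩
    refine ((Set.finite_singleton v).union (F.finite_toSet.biUnion hfin)).subset fun w hw => ?_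
    by_cases hwv : w = v
    · exact Or.inl hwv
    · exact Or.inr (Set.mem_biUnion (hs v hv w hw (Ne.symm hwv)) ⟨hw, hwv, rfl⟩)

/-- Finitely many relations without monochromatic triangles do not cover the pairs of different
terms of a sequence of points. -/
theorem false_of_no_monochromatic {V : Type v} {K : Type u} [Finite K] (R : K → Set (V × V))
    (v : ℕ → V) (hR : ∀ i j, i ≠ j → ∃ k, (v i, v j) ∈ R k)
    (hmono : ∀ k x y z, (x, y) ∈ R k → (y, z) ∈ R k → (x, z) ∉ R k) : False := by
  classical
  have := Fintype.ofFinite K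
  obtain ⟨k₀, -⟩ := hR 0 1 (by norm_num)
  let col : ℕ → ℕ → K := fun i j => if h : i ≠ j then (hR i j h).choose else k₀
  have hcol : ∀ i j, i ≠ j → (v i, v j) ∈ R (col i j) := fun i j h => by
    simp only [col, dif_pos h]
    exact (hR i j h).choose_spec
  refine Set.infinite_univ (finite_of_no_monochromatic col Finset.univ (Set.univ : Set ℕ)
    (fun _ _ _ _ _ => Finset.mem_univ _) fun x _ y _ z _ hxy hyz hxz h => ?_)
  refine hmono (col x z) (v x) (v y) (v z) ?_ ?_ (hcol x z hxz)
  · exact h.1 ▸ hcol x y hxy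
  · exact h.2 ▸ hcol y z hyz

section

variable {A : Type u} [RelationAlgebra A] {U : Type v} {ρ : A → Set (U × U)}

theorem IsRepresentation.mono (h : IsRepresentation ρ) {x y : A} (hxy : x ≤ y) : ρ x ⊆ ρ y := by
  rw [← sup_eq_right.2 hxy, h.map_sup]
  exact Set.subset_union_left

theorem IsRepresentation.disjoint (h : IsRepresentation ρ) {x y : A} (hxy : x ≤ yᶜ) {s : U × U}
    (hx : s ∈ ρ x) : s ∉ ρ y := by
  have := h.mono hxy hx
  rw [h.map_compl] at this
  exact this.2

theorem IsRepresentation.map_bot (h : IsRepresentation ρ) : ρ ⊥ = ∅ := by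
  rw [← compl_top, h.map_compl, Set.sdiff_self]

/-- A representation of an algebra with infinitely many pairwise disjoint elements `a i` such that
`1' ≤ a i ; a i` gives infinitely many distinct points, all related to a common one. -/
theorem IsRepresentation.exists_points [Nontrivial A] (h : IsRepresentation ρ)
    (hs : IsSymmetric A) (a : ℕ → A) (ha : ∀ i, RelOps.ident ≤ a i ⨾ a i)
    (hd : ∀ i j, i ≠ j → a i ≤ (a j)ᶜ) :
    ∃ v : ℕ → U, Function.Injective v ∧ ∀ i j, (v i, v j) ∈ ρ (a i ⨾ a j) := by
  obtain ⟨u⟩ : Nonempty U := by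
    by_contra hU
    rw [not_nonempty_iff] at hU
    obtain ⟨x, y, hxy⟩ := exists_pair_ne A
    exact hxy (h.injective (Subsingleton.elim _ _))
  have hu : (u, u) ∈ ρ RelOps.ident := by
    rw [h.map_ident]
    rfl
  have hv : ∀ i, ∃ w, (u, w) ∈ ρ (a i) := fun i => by
    have := h.mono (ha i) hu
    rw [h.map_comp] at this
    obtain ⟨w, hw, -⟩ := this
    exact ⟨w, hw⟩
  choose v hv using hv
  refine ⟨v, fun i j hij => ?_, fun i j => ?_⟩
  · by_contra hne
    exact h.disjoint (hd i j hne) (hv i) (hij ▸ hv j)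
  · rw [h.map_comp]
    refine ⟨u, ?_, hv j⟩
    have := hv i
    rw [← hs (a i), h.map_conv] at this
    exact this

end

/-! ### The completion is not representable -/

/-- The atoms of color `k`. -/
def colorSet (k : K) : SplitAlgebra hc :=
  ({z | ∃ p, z = some p ∧ c p.base = k} : Set (Option (SplitAtom c)))

theorem not_isRepresentable_splitAlgebra : ¬ IsRepresentable (SplitAlgebra hc) := by
  classical
  have : Finite K := Nat.finite_of_card_ne_zero (by have := hK.out; omega)
  have := Fintype.ofFinite K
  rintro ⟨U, ρ, hρ⟩
  have : Nontrivial (SplitAlgebra hc) := (splitAlgebra_isIntegral hc).1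
  obtain ⟨k₀⟩ : Nonempty K := by
    by_contra h
    rw [not_nonempty_iff] at h
    have := hK.out
    simp at this
  obtain ⟨V, W, hV, -, -⟩ := exists_blur_pair hK.out k₀
  obtain ⟨x, rfl⟩ := hc k₀
  let p : ℕ → SplitAtom c := fun i => ⟨x, i, V, hV⟩
  obtain ⟨v, -, hvρ⟩ := hρ.exists_points (splitAlgebra_isSymmetric hc)
    (fun i => single (some (p i)))
    (fun i => by
      rintro _ rfl
      exact ⟨_, rfl, _, rfl, by simp⟩)
    (fun i j hij => by
      rintro _ rfl h
      have := congrArg SplitAtom.idx (Option.some.inj h)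
      exact hij this)
  have hsup : ∀ F : Finset K, ρ (F.sup (colorSet hc)) ⊆ ⋃ k, ρ (colorSet hc k) := fun F => by
    induction F using Finset.induction_on with
    | empty => rw [Finset.sup_empty, hρ.map_bot]; exact Set.empty_subset _
    | insert k F _ ih =>
      rw [Finset.sup_insert, hρ.map_sup]
      exact Set.union_subset (Set.subset_iUnion (fun k => ρ (colorSet hc k)) k) ih
  refine false_of_no_monochromatic (fun k => ρ (colorSet hc k)) v (fun i j hij => ?_)
    fun k a b d hab hbd had => ?_
  · refine Set.mem_iUnion.1 (hsup Finset.univ (hρ.mono ?_ (hvρ i j)))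
    rintro z ⟨y, rfl, w, rfl, h⟩
    rcases z with _ | r
    · rw [cyc_none_right] at h
      exact absurd (congrArg SplitAtom.idx (Option.some.inj h)) hij
    · exact (Finset.le_sup (f := colorSet hc) (Finset.mem_univ (c r.base))) ⟨r, rfl, rfl⟩
  · refine hρ.disjoint (x := colorSet hc k) (y := colorSet hc k ⨾ colorSet hc k) ?_ had ?_
    · rintro _ ⟨r, rfl, hr⟩ ⟨_, ⟨p, rfl, hp⟩, _, ⟨q, rfl, hq⟩, h⟩
      exact not_tri_of_color_eq hc (hp.trans hr.symm) (hq.trans hr.symm) h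
    · rw [hρ.map_comp]
      exact ⟨b, hab, hbd⟩

theorem not_isCompletelyRepresentable_termAlgebra :
    ¬ IsCompletelyRepresentable (termAlgebra hc) := by
  classical
  have : Finite K := Nat.finite_of_card_ne_zero (by have := hK.out; omega)
  rintro ⟨U, ρ, hρ, hjoin⟩
  have : Nontrivial (termAlgebra hc) :=
    (Subalgebra.isIntegral (splitAlgebra_isIntegral hc) _).1
  obtain ⟨k₀⟩ : Nonempty K := by
    by_contra h
    rw [not_nonempty_iff] at h
    have := hK.out
    simp at this
  obtain ⟨V, W, hV, -, -⟩ := exists_blur_pair hK.out k₀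
  obtain ⟨x, rfl⟩ := hc k₀
  let p : ℕ → SplitAtom c := fun i => ⟨x, i, V, hV⟩
  obtain ⟨v, hv, hvρ⟩ := hρ.exists_points
    (Subalgebra.isSymmetric (splitAlgebra_isSymmetric hc) _)
    (fun i => termSingle hc (some (p i)))
    (fun i => by
      rintro _ rfl
      exact ⟨_, rfl, _, rfl, by simp⟩)
    (fun i j hij => by
      rintro _ rfl h
      have := congrArg SplitAtom.idx (Option.some.inj h)
      exact hij this)
  have htop : ρ ⊤ = ⋃ a ∈ Set.range (termSingle hc), ρ a :=
    hjoin _ _ ⟨fun _ _ => le_top, fun X hX q _ => (termSingle_le hc).1 (hX ⟨q, rfl⟩)⟩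
  refine false_of_no_monochromatic
    (fun k => {s | ∃ q : SplitAtom c, c q.base = k ∧ s ∈ ρ (termSingle hc (some q))}) v
    (fun i j hij => ?_) fun k a b d => ?_
  · have h := hρ.mono le_top (hvρ i j)
    rw [htop] at h
    simp only [Set.mem_range, Set.iUnion_exists, Set.iUnion_iUnion_eq', Set.mem_iUnion] at h
    obtain ⟨z, hz⟩ := h
    rcases z with _ | q
    · have : (v i, v j) ∈ ρ RelOps.ident := hz
      rw [hρ.map_ident] at this
      exact absurd (hv this) hij
    · exact ⟨c q.base, q, rfl, hz⟩
  · rintro ⟨q, hq, hab⟩ ⟨r, hr, hbd⟩ ⟨s, hs, had⟩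
    refine hρ.disjoint (x := termSingle hc (some s))
      (y := termSingle hc (some q) ⨾ termSingle hc (some r)) ?_ had ?_
    · rintro _ rfl ⟨_, rfl, _, rfl, h⟩
      exact not_tri_of_color_eq hc (hq.trans hs.symm) (hr.trans hs.symm) h
    · rw [hρ.map_comp]
      exact ⟨b, hab, hbd⟩

end RelationAlgebra

namespace RelationAlgebra

open BlurredTriples SetAlgebra

/-! ### Embedding finite Monk algebras -/

section

variable {A : Type u}

theorem isAtom_le_sup [BooleanAlgebra A] {z x y : A} (hz : IsAtom z) (h : z ≤ x ⊔ y) :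
    z ≤ x ∨ z ≤ y := by
  by_contra! hn
  have h₁ := hz.not_le_iff_disjoint.1 hn.1
  have h₂ := hz.not_le_iff_disjoint.1 hn.2
  exact hz.1 (disjoint_self.1 ((h₁.sup_right h₂).mono_right h))

theorem isAtom_le_compl_iff [BooleanAlgebra A] {z x : A} (hz : IsAtom z) : z ≤ xᶜ ↔ ¬ z ≤ x := by
  rw [le_compl_iff_disjoint_right, hz.not_le_iff_disjoint]

theorem le_of_forall_isAtom_le [BooleanAlgebra A] [IsAtomic A] {x y : A}
    (h : ∀ z, IsAtom z → z ≤ x → z ≤ y) : x ≤ y := by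
  rw [← sdiff_eq_bot_iff]
  rcases eq_bot_or_exists_atom_le (x \ y) with h' | ⟨z, hz, hzx⟩
  · exact h'
  · have h₁ := h z hz (hzx.trans sdiff_le)
    have h₂ : z ≤ yᶜ := hzx.trans (by rw [sdiff_eq]; exact inf_le_right)
    exact absurd h₁ ((isAtom_le_compl_iff hz).1 h₂)

variable [RelationAlgebra A] [Finite A]

theorem IsSymmetric.exists_isAtom_le_comp_left (hs : IsSymmetric A) {a b z : A} (hz : IsAtom z)
    (h : z ≤ a ⨾ b) : ∃ x, IsAtom x ∧ x ≤ a ∧ z ≤ x ⨾ b := by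
  obtain ⟨m, ⟨hma, hm⟩, hmin⟩ := WellFounded.has_min (wellFounded_lt (α := A))
    {x | x ≤ a ∧ z ≤ x ⨾ b} ⟨a, le_rfl, h⟩
  refine ⟨m, ⟨fun h' => ?_, fun w hw => ?_⟩, hma, hm⟩
  · rw [h', hs.comp_comm, hs.comp_bot] at hm
    exact hz.1 (le_bot_iff.1 hm)
  · have hm' : m = w ⊔ m \ w := (sup_sdiff_cancel_right hw.le).symm
    rw [hm', sup_comp] at hm
    rcases isAtom_le_sup hz hm with h' | h'
    · exact absurd hw (hmin w ⟨hw.le.trans hma, h'⟩)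
    · have h₁ : m \ w = m := by
        by_contra hne
        exact hmin _ ⟨sdiff_le.trans hma, h'⟩ (lt_of_le_of_ne sdiff_le hne)
      exact le_bot_iff.1 ((disjoint_sdiff_self_left.mono_left h₁.ge) hw.le le_rfl)

/-- In a finite algebra, relative multiplication is determined by its values on atoms. -/
theorem IsSymmetric.exists_isAtom_le_comp (hs : IsSymmetric A) {a b z : A} (hz : IsAtom z)
    (h : z ≤ a ⨾ b) : ∃ x y, IsAtom x ∧ IsAtom y ∧ x ≤ a ∧ y ≤ b ∧ z ≤ x ⨾ y := by
  obtain ⟨x, hx, hxa, h₁⟩ := hs.exists_isAtom_le_comp_left hz h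
  rw [hs.comp_comm] at h₁
  obtain ⟨y, hy, hyb, h₂⟩ := hs.exists_isAtom_le_comp_left hz h₁
  rw [hs.comp_comm] at h₂
  exact ⟨x, y, hx, hy, hxa, hyb, h₂⟩

/-- The diversity atoms of a finite Monk algebra have a color, and the cycles are given by the
absence of triples of a single color. -/
theorem IsMonkAlgebra.exists_color {E : Subalgebra A} (hA : IsMonkAlgebra A E) :
    ∃ c : {x : A // IsDiversityAtom x} → colors E, Function.Surjective c ∧
      (∀ x y : {x : A // IsDiversityAtom x}, RelOps.ident ≤ x.1 ⨾ y.1 ↔ x = y) ∧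
      ∀ x y z : {x : A // IsDiversityAtom x}, z.1 ≤ x.1 ⨾ y.1 ↔ ¬ (c x = c z ∧ c y = c z) := by
  have hi : IsAtom (RelOps.ident : A) := hA.integral.isAtom_ident hA.symmetric
  obtain ⟨q, -, hE⟩ := hA.noOneCycles
  have hiE : IsAtom (RelOps.ident : E) := hE.integral.isAtom_ident hE.symmetric
  have hcover : ∀ x : {x : A // IsDiversityAtom x}, ∃ k : colors E, x.1 ≤ k.1.1 := fun x => by
    obtain ⟨k, hk, hxk⟩ := hA.splitting.exists_cover x.1 x.2.1
    refine ⟨⟨k, isDiversityAtom_of_ne hiE hk ?_⟩, hxk⟩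
    rintro rfl
    exact (isAtom_le_compl_iff x.2.1).1 x.2.2 hxk
  choose c hc using hcover
  have hunique : ∀ (x : {x : A // IsDiversityAtom x}) (k : colors E), x.1 ≤ k.1.1 → c x = k := by
    intro x k hxk
    by_contra hne
    have h₁ : (c x).1 ⊓ k.1 = ⊥ := by
      refine disjoint_iff.1 ((c x).2.1.not_le_iff_disjoint.1 fun h => ?_)
      rcases k.2.1.le_iff.1 h with h' | h'
      · exact (c x).2.1.1 h'
      · exact hne (Subtype.ext h')
    have h₂ : (c x).1.1 ⊓ k.1.1 = ⊥ := Subtype.ext_iff.1 h₁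
    exact x.2.1.1 (le_bot_iff.1 ((le_inf (hc x) hxk).trans_eq h₂))
  have hprod : ∀ k l : colors E, k ≠ l → k.1.1 ⨾ l.1.1 = (RelOps.ident : A)ᶜ := fun k l h =>
    Subtype.ext_iff.1 (hE.comp_of_ne k.1 l.1 k.2 l.2 fun h' => h (Subtype.ext h'))
  have hsquare : ∀ k : colors E, k.1.1 ⨾ k.1.1 = k.1.1ᶜ := fun k =>
    Subtype.ext_iff.1 (hE.comp_self k.1 k.2)
  have hcomp : ∀ x y : {x : A // IsDiversityAtom x}, x ≠ y →
      x.1 ⨾ y.1 = ((c x).1.1 ⨾ (c y).1.1) ⊓ (RelOps.ident : A)ᶜ := fun x y h => by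
    rw [hA.splitting.comp_eq x.1 y.1 (c x).1 (c y).1 x.2 y.2 (c x).2.1 (c y).2.1 (hc x) (hc y),
      if_neg]
    rw [hA.symmetric]
    exact fun h' => h (Subtype.ext h')
  have hcomp' : ∀ x : {x : A // IsDiversityAtom x}, x.1 ⨾ x.1 = (c x).1.1 ⨾ (c x).1.1 :=
    fun x => by
    rw [hA.splitting.comp_eq x.1 x.1 (c x).1 (c x).1 x.2 x.2 (c x).2.1 (c x).2.1 (hc x) (hc x),
      if_pos (hA.symmetric _).symm]
  refine ⟨c, fun k => ?_, fun x y => ⟨fun h => ?_, ?_⟩, fun x y z => ?_⟩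
  · have hk : k.1.1 ≠ ⊥ := fun h => k.2.1.1 (Subtype.ext h)
    obtain ⟨x, hx, hxk⟩ := (eq_bot_or_exists_atom_le k.1.1).resolve_left hk
    have hk' : k.1.1 ≤ (RelOps.ident : A)ᶜ := k.2.2
    exact ⟨⟨x, hx, hxk.trans hk'⟩, hunique _ k hxk⟩
  · by_contra hne
    rw [hcomp x y hne] at h
    exact hi.1 (le_compl_self.1 (h.trans inf_le_right))
  · rintro rfl
    have hk : (c x).1.1 ≤ (RelOps.ident : A)ᶜ := (c x).2.2
    rw [hcomp', hsquare]
    exact le_compl_comm.1 hk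
  · have h₁ : z.1 ≤ x.1 ⨾ y.1 ↔ z.1 ≤ (c x).1.1 ⨾ (c y).1.1 := by
      by_cases hxy : x = y
      · subst hxy
        rw [hcomp']
      · rw [hcomp x y hxy, le_inf_iff, and_iff_left z.2.2]
    rw [h₁]
    by_cases hxy : c x = c y
    · rw [← hxy, hsquare, isAtom_le_compl_iff z.2.1, and_self, not_iff_not]
      exact ⟨fun h => (hunique z _ h).symm, fun h => h ▸ hc z⟩
    · rw [hprod _ _ hxy]
      exact iff_of_true z.2.2 fun h => hxy (h.1.trans h.2.symm)

/-- The embedding into the blown-up algebra sends an element to the set of all copies of the atoms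
below it. -/
theorem exists_embedding_of_color (hs : IsSymmetric A) (hi : IsAtom (RelOps.ident : A))
    {K : Type u} [hK : Fact (6 ≤ Nat.card K)] {c : {x : A // IsDiversityAtom x} → K}
    (hc : Function.Surjective c)
    (hid : ∀ x y : {x : A // IsDiversityAtom x}, RelOps.ident ≤ x.1 ⨾ y.1 ↔ x = y)
    (htri : ∀ x y z : {x : A // IsDiversityAtom x},
      z.1 ≤ x.1 ⨾ y.1 ↔ ¬ (c x = c z ∧ c y = c z)) :
    ∃ f : A → SplitAlgebra hc, IsEmbedding f := by
  have hcases : ∀ x : A, IsAtom x → x = RelOps.ident ∨ IsDiversityAtom x := fun x hx =>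
    or_iff_not_imp_left.2 (isDiversityAtom_of_ne hi hx)
  have hcopy : ∀ (x : {x : A // IsDiversityAtom x}) (n : ℕ),
      ∃ p : SplitAtom c, p.base = x ∧ p.idx = n := fun x n => by
    obtain ⟨V, W, hV, -, -⟩ := exists_blur_pair hK.out (c x)
    exact ⟨⟨x, n, V, hV⟩, rfl, rfl⟩
  let g : Option (SplitAtom c) → A := fun z => z.elim RelOps.ident fun p => p.base.1
  have hg : ∀ z, IsAtom (g z) := fun z => by
    rcases z with _ | p
    · exact hi
    · exact p.base.2.1
  have hgs : ∀ x, IsAtom x → ∃ z, g z = x := fun x hx => by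
    rcases hcases x hx with rfl | h
    · exact ⟨none, rfl⟩
    · obtain ⟨p, hp, -⟩ := hcopy ⟨x, h⟩ 0
      exact ⟨some p, by simp [g, hp]⟩
  let f : A → SplitAlgebra hc := fun a => ({z | g z ≤ a} : Set _)
  have hf : ∀ a z, z ∈ f a ↔ g z ≤ a := fun _ _ => Iff.rfl
  have hinj : ∀ a b, f a ≤ f b → a ≤ b := fun a b h => le_of_forall_isAtom_le fun x hx hxa => by
    obtain ⟨z, rfl⟩ := hgs x hx
    exact h hxa
  refine ⟨f, ⟨fun a b => ?_, fun a => ?_, fun a b => ?_, fun a => ?_, ?_⟩,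
    fun a b h => le_antisymm (hinj a b h.le) (hinj b a h.ge)⟩
  · ext z
    rw [mem_sup, hf, hf, hf]
    exact ⟨isAtom_le_sup (hg z), fun h => h.elim (·.trans le_sup_left) (·.trans le_sup_right)⟩
  · ext z
    rw [mem_compl, hf, hf]
    exact isAtom_le_compl_iff (hg z)
  · ext z
    rw [mem_comp, hf]
    constructor
    · intro h
      obtain ⟨x, y, hx, hy, hxa, hyb, h⟩ := hs.exists_isAtom_le_comp (hg z) h
      rcases hcases x hx with rfl | hx'
      · rw [hs.ident_comp] at h
        exact ⟨none, hxa, z, h.trans hyb, rfl⟩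
      rcases hcases y hy with rfl | hy'
      · rw [comp_ident] at h
        exact ⟨z, h.trans hxa, none, hyb, by simp⟩
      rcases z with _ | r
      · obtain rfl := congrArg Subtype.val ((hid ⟨x, hx'⟩ ⟨y, hy'⟩).1 h)
        obtain ⟨p, hp, -⟩ := hcopy ⟨x, hx'⟩ 0
        have hpx : g (some p) = x := by simp [g, hp]
        exact ⟨some p, by rw [hf, hpx]; exact hxa, some p, by rw [hf, hpx]; exact hyb, by simp⟩
      · -- Copies with the same index as `r` form a cycle unless all three colors agree.
        obtain ⟨p, hp, hpi⟩ := hcopy ⟨x, hx'⟩ r.idx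
        obtain ⟨q, hq, hqi⟩ := hcopy ⟨y, hy'⟩ r.idx
        have hpx : g (some p) = x := by simp [g, hp]
        have hqy : g (some q) = y := by simp [g, hq]
        refine ⟨some p, by rw [hf, hpx]; exact hxa, some q, by rw [hf, hqy]; exact hyb, ?_⟩
        rw [cyc_some, splitTriples_tri, hpi, hqi, hp, hq]
        exact Or.inr ⟨by simp, (htri ⟨x, hx'⟩ ⟨y, hy'⟩ r.base).1 h⟩
    · rintro ⟨x, hx, y, hy, h⟩
      refine le_trans ?_ (hs.comp_mono ((hf _ _).1 hx) ((hf _ _).1 hy))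
      rcases x with _ | p
      · obtain rfl : y = z := h
        exact (hs.ident_comp _).ge
      rcases y with _ | q
      · obtain rfl : some p = z := h
        exact (comp_ident _).ge
      rcases z with _ | r
      · rw [cyc_none_right] at h
        obtain rfl := Option.some.inj h
        exact (hid _ _).2 rfl
      · exact (htri _ _ _).2 fun h' => not_tri_of_color_eq hc h'.1 h'.2 h
  · rw [hs]
    rfl
  · ext z
    rw [hf, mem_ident]
    rcases z with _ | p
    · exact iff_of_true le_rfl rfl
    · exact iff_of_false (fun h => (isAtom_le_compl_iff p.base.2.1).1 p.base.2.2 h)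
        (Option.some_ne_none p)

end

end RelationAlgebra

theorem corollary1 (A : Type u) [RelationAlgebra A] [Finite A] (E : RelationAlgebra.Subalgebra A)
    (hA : RelationAlgebra.IsMonkAlgebra A E) (hE : 6 ≤ (RelationAlgebra.colors E).ncard) :
    RelationAlgebra.IsFGSubcompletion A ∧
    ∃ (C : Type u) (_ : RelationAlgebra C) (B : RelationAlgebra.Subalgebra C),
      -- `C` is the completion of `B`, and `A` is (isomorphic to) a subalgebra of `C`
      RelationAlgebra.IsCompletionOf C B ∧
      (∃ f : A → C, RelationAlgebra.IsEmbedding f) ∧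
      -- `B` is countable, atomic, symmetric, integral, and generated by its atoms
      Countable B ∧ IsAtomic B ∧ RelationAlgebra.IsSymmetric B ∧ RelationAlgebra.IsIntegral B ∧
      RelationAlgebra.GeneratedBy B {b : B | IsAtom b} ∧
      -- finitely generated subalgebras of `B`
      (∀ F : RelationAlgebra.Subalgebra B, F.FG →
        ∃ G : RelationAlgebra.Subalgebra B, (F : Set B) ⊆ (G : Set B) ∧ Finite G ∧
          RelationAlgebra.OnePointExtensionProperty G) ∧
      -- the inclusion of `B` in `C` identifies the two atom structures
      (∃ e : {b : B // IsAtom b} → {c : C // IsAtom c}, (∀ b, (e b : C) = ((b : B) : C)) ∧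
        (RelationAlgebra.atomStructure B).IsIso (RelationAlgebra.atomStructure C) e) ∧
      -- `C` is isomorphic to the complex algebra of the atom structure of `B`
      (∃ g : C → RelationAlgebra.ComplexAlgebra (RelationAlgebra.atomStructure B),
        RelationAlgebra.IsIso g) ∧
      ¬ RelationAlgebra.IsRepresentable C ∧
      RelationAlgebra.IsRepresentable B ∧
      ¬ RelationAlgebra.IsCompletelyRepresentable B := by
  obtain ⟨c, hc, hid, htri⟩ := hA.exists_color
  have hK : Fact (6 ≤ Nat.card (RelationAlgebra.colors E)) := ⟨hE⟩
  have hemb := RelationAlgebra.exists_embedding_of_color hA.symmetric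
    (hA.integral.isAtom_ident hA.symmetric) hc hid htri
  have hcompl := RelationAlgebra.isCompletionOf_termAlgebra hc
  have hatomic := RelationAlgebra.termAlgebra_isAtomic hc
  have hrep := RelationAlgebra.isRepresentable_termAlgebra hc
  have hnot := RelationAlgebra.not_isRepresentable_splitAlgebra hc
  refine ⟨⟨⟨Set.univ, Set.toFinite _, fun a S hS => hS (Set.mem_univ a)⟩,
    RelationAlgebra.SplitAlgebra hc, inferInstance, RelationAlgebra.termAlgebra hc,
    hatomic, hrep, hcompl, hnot, hemb⟩,
    RelationAlgebra.SplitAlgebra hc, inferInstance, RelationAlgebra.termAlgebra hc, hcompl, hemb,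
    RelationAlgebra.countable_termAlgebra hc, hatomic,
    RelationAlgebra.Subalgebra.isSymmetric (RelationAlgebra.splitAlgebra_isSymmetric hc) _,
    RelationAlgebra.Subalgebra.isIntegral (RelationAlgebra.splitAlgebra_isIntegral hc) _,
    RelationAlgebra.generatedBy_atoms hc, fun F hF => ?_,
    RelationAlgebra.exists_atomStructure_isIso hc, RelationAlgebra.exists_complexAlgebra_isIso hc,
    hnot, hrep, RelationAlgebra.not_isCompletelyRepresentable_termAlgebra hc⟩
  obtain ⟨M, hM⟩ := RelationAlgebra.exists_subset_termUniform hc F hF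
  exact ⟨RelationAlgebra.termUniform hc M, hM, RelationAlgebra.finite_termUniform hc M,
    RelationAlgebra.termUniform_onePointExtensionProperty hc M⟩
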